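/- Let $\mathcal X$ be a measurable space. Labels $y$ and attributes $a$ lie in $\{0,1\}$. Let $P_{src}(x,a,y)$ be a source probability distribution and $P_{trg}(x,a)$ a target probability distribution such that the marginal $P_{src}(x,a)$ is absolutely continuous with respect to $P_{trg}(x,a)$; the density is written $P_{src}(x,a)/P_{trg}(x,a)$. Let $\phi(x,y)\in\mathbb R^m$ be a feature function such that $\phi(X,0)$ and $\phi(X,1)$ are integrable under $P_{src}$. Let $\mu\in\mathbb R$ and let $\Delta$ be the set of (measurable) conditional label distributions $P(y|x,a)$. Put $g_k(a,y)=\mathbb I(a=k\wedge y=1)$ and $\tilde g_k=\mathbb E_{P_{trg}(x,a)\tilde P(y|x,a)}[g_k(A,Y)]$ for $k\in\{0,1\}$, where $\tilde P\in\Delta$ is a given estimate of the target label distribution, and assume $\tilde g_0,\tilde g_1>0$. Let $f(a,y,\hat y)=1/\tilde g_1$ if $a=y=\hat y=1$, $f(a,y,\hat y)=-1/\tilde g_0$ if $a=0$, $y=\hat y=1$, and $f=0$ otherwise. The fair robust predictor for equalized opportunity is a minimizer over $P\in\Delta$ of $\sup_{Q\in\Delta\cap\Xi\cap\Gamma}J(P,Q)$,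 where $$J(P,Q)=\mathbb E_{P_{trg}(x,a)Q(y|x,a)}[-\log P(Y|X,A)]+\mu\,\mathbb E_{P_{trg}(x,a)Q(y'|x,a)P(y|x,a)}[f(A,Y',Y)]\in(-\infty,\infty],$$ $$\Xi:\ \mathbb E_{P_{src}(x,a)Q(y|x,a)}[\phi(X,Y)]=\mathbb E_{P_{src}}[\phi(X,Y)],\qquad \Gamma:\ \mathbb E_{P_{trg}(x,a)Q(y|x,a)}[g_k(A,Y)]=\tilde g_k\quad(k=0,1).$$ The Lagrangian $L_{\theta,\lambda}(P,Q)$ adds $\theta^{T}\big(\mathbb E_{P_{src}(x,a)Q}[\phi]-\mathbb E_{P_{src}}[\phi]\big)+\sum_k\lambda_k\big(\mathbb E_{P_{trg}Q}[g_k]-\tilde g_k\big)$ to $J(P,Q)$. Dual multipliers are minimizers $(\theta,\lambda)\in\mathbb R^m\times\mathbb R^2$ of $\inf_{P\in\Delta}\sup_{Q\in\Delta}L_{\theta,\lambda}(P,Q)$. An equilibrium given $(\theta,\lambda)$ is a pair $(P,Q)\in\Delta\times\Delta$ with $L_{\theta,\lambda}(P,Q')\le L_{\theta,\lambda}(P,Q)\le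 L_{\theta,\lambda}(P',Q)$ for all $P',Q'\in\Delta$. Consider the equation $$E_{\theta,\lambda}(x,a):=\log\frac{1-P(1|x,a)}{P(1|x,a)}+\mu\,\mathbb E_{P(y'|x,a)}[f(a,1,Y')]+\frac{P_{src}(x,a)}{P_{trg}(x,a)}\theta^{T}\big(\phi(x,1)-\phi(x,0)\big)+\sum_{k\in\{0,1\}}\lambda_kg_k(a,1)=0\qquad(1)$$ with the range condition $$0<P(1|x,a)\le\tfrac1{\mu f(a,1,1)}\ \text{ if }\mu f(a,1,1)>1,\qquad 0<P(1|x,a)<1\ \text{ otherwise},\qquad(2)$$ and the formula $$Q(1|x,a)=\frac{P(1|x,a)}{1-\mu f(a,1,1)P(1|x,a)+\mu f(a,1,1)P(1|x,a)^2}.\qquad(3)$$ All relations at $(x,a)$ are meant for $P_{trg}$-almost every $(x,a)$. Then: (i) If $(\theta,\lambda)$ are dual multipliers and $P$ satisfies (1) and (2), then $P$ is a fair robust predictor, and every $Q\in\Delta$ satisfying (3) lies in $\Xi\cap\Gamma$ and forms with $P$ a saddle point of $J$ over $\Delta\times(\Delta\cap\Xi\cap\Gamma)$. (ii) For arbitrary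 $(\theta,\lambda)$, if $P$ satisfies (1) and (2), then there is $Q\in\Delta$ satisfying (3), and every such $Q$ is in equilibrium with $P$ given $(\theta,\lambda)$. (iii) For $0<P(1|x,a)<1$, condition (2) holds if and only if the right-hand side of (3) is defined and lies in $[0,1]$. (iv) Conversely, say that $P$ satisfies the truncated equation if (2) holds and, at each $(x,a)$, either (1) holds, or $\mu f(a,1,1)>1$, $P(1|x,a)=1/(\mu f(a,1,1))$ and $E_{\theta,\lambda}(x,a)>0$. If $(\theta,\lambda)$ are dual multipliers, then $P\in\Delta$ is a fair robust predictor if and only if it satisfies the truncated equation. For arbitrary $(\theta,\lambda)$, a pair $(P,Q)$ is an equilibrium given $(\theta,\lambda)$ if and only if $P$ satisfies the truncated equation and $Q$ satisfies (3). (v) For all $(\theta,\lambda)$ an equilibrium exists. If some $Q\in\Delta\cap\Xi\cap\Gamma$ has $0<Q(1|x,a)<1$ for almost every $(x,a)$, then dual multipliers exist. -/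

import Mathlib

open MeasureTheory
open scoped ENNReal Matrix

noncomputable section

namespace FairShift

/-- Conditional label distributions `P(y | x, a)` on `{0, 1}`: the conditional probability
simplex `Δ`. A covariate is a pair `z = (x, a)` of features and a group attribute `a ∈ {0, 1}`. -/
structure CondProb (X : Type*) [MeasurableSpace X] where
  /-- `prob z y` is the conditional probability of label `y` given `z = (x, a)`. -/
  prob : X × Fin 2 → Fin 2 → ℝ
  nonneg : ∀ z y, 0 ≤ prob z y
  sum_eq_one : ∀ z, ∑ y, prob z y = 1
  measurable : ∀ y, Measurable fun z => prob z y

/-- The data of the game: source distribution of `(X, A, Y)`, target distribution of `(X, A)`,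
feature function, label model used to estimate the group marginals on target, and penalty
weight. -/
structure Game (X : Type*) [MeasurableSpace X] (m : ℕ) where
  /-- source distribution of `(X, A, Y)` -/
  src : Measure (X × Fin 2 × Fin 2)
  /-- target distribution of `(X, A)` -/
  trg : Measure (X × Fin 2)
  /-- feature function `φ(x, y)` -/
  feat : X → Fin 2 → Fin m → ℝ
  /-- estimate of the target label distribution given `(x, a)` -/
  est : CondProb X
  /-- fairness penalty weight `μ` -/
  mu : ℝ

/-- The loss `-log p` of a probability `p ∈ [0, 1]`, equal to `+∞` at `p = 0`. -/
def logLoss (p : ℝ) : ℝ≥0∞ :=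
  if p = 0 then ⊤ else ENNReal.ofReal (-Real.log p)

/-- Group selector for equalized opportunity: `g_k(a, y) = 1` if `a = k` and `y = 1`, else `0`. -/
def selector (k a y : Fin 2) : ℝ :=
  if a = k ∧ y = 1 then 1 else 0

namespace Game

variable {X : Type*} [MeasurableSpace X] {m : ℕ} (G : Game X m)

/-- Source distribution of `(X, A)`. -/
def srcXA : Measure (X × Fin 2) :=
  G.src.map fun w => (w.1, w.2.1)

/-- The ratio `P_src(x, a) / P_trg(x, a)`. -/
def ratio (z : X × Fin 2) : ℝ :=
  (G.srcXA.rnDeriv G.trg z).toReal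

/-- Expectation of `g_k(A, Y)` when `(X, A)` follows the target distribution and `Y` follows
`Q(· | X, A)`. -/
def groupMean (Q : CondProb X) (k : Fin 2) : ℝ :=
  ∫ z, ∑ y, Q.prob z y * selector k z.2 y ∂G.trg

/-- The estimated group density on target. -/
def gtil (k : Fin 2) : ℝ := G.groupMean G.est k

/-- The weighting function `f(a, y, ŷ)` of the mean score difference between the groups. -/
def weight (a y yhat : Fin 2) : ℝ :=
  if (a = 1 ∧ y = 1) ∧ yhat = 1 then 1 / G.gtil 1
  else if (a = 0 ∧ y = 1) ∧ yhat = 1 then -(1 / G.gtil 0)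
  else 0

/-- Expectation of `φ(X, Y)` when `(X, A)` follows the source distribution and `Y` follows
`Q(· | X, A)`. -/
def featMean (Q : CondProb X) : Fin m → ℝ :=
  ∫ z, ∑ y, Q.prob z y • G.feat z.1 y ∂G.srcXA

/-- Expectation of `φ(X, Y)` under the source distribution. -/
def srcFeatMean : Fin m → ℝ :=
  ∫ w, G.feat w.1 w.2.2 ∂G.src

/-- The constraint set `Ξ ∩ Γ` of the adversary: source features and target group marginals are
matched. -/
def Feasible (Q : CondProb X) : Prop :=
  G.featMean Q = G.srcFeatMean ∧ ∀ k, G.groupMean Q k = G.gtil k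

/-- Expected log-loss of `P` on target, with labels drawn from `Q`. -/
def expLogLoss (P Q : CondProb X) : ℝ≥0∞ :=
  ∫⁻ z, ∑ y, ENNReal.ofReal (Q.prob z y) * logLoss (P.prob z y) ∂G.trg

/-- Expected fairness weight `f(A, Y', Y)` on target, where `Y'` is drawn from `Q` and,
independently given `(X, A)`, the prediction `Y` is drawn from `P`. -/
def fairPenalty (P Q : CondProb X) : ℝ :=
  ∫ z, ∑ y', ∑ y, Q.prob z y' * P.prob z y * G.weight z.2 y' y ∂G.trg

/-- The objective of the game; it may be `+∞`. -/
def objective (P Q : CondProb X) : EReal :=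
  (G.expLogLoss P Q : EReal) + ((G.mu * G.fairPenalty P Q : ℝ) : EReal)

/-- `P` is a fair robust log-loss predictor under covariate shift: it minimizes over `Δ` the
largest value of the objective over `Δ ∩ Ξ ∩ Γ`. -/
def IsFairRobust (P : CondProb X) : Prop :=
  ∀ P' : CondProb X,
    (⨆ (Q : CondProb X) (_ : G.Feasible Q), G.objective P Q) ≤
      ⨆ (Q : CondProb X) (_ : G.Feasible Q), G.objective P' Q

/-- `(P, Q)` is a saddle point of the game with the constraints on the adversary. -/
def IsSaddle (P Q : CondProb X) : Prop :=
  G.Feasible Q ∧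
    (∀ Q' : CondProb X, G.Feasible Q' → G.objective P Q' ≤ G.objective P Q) ∧
    ∀ P' : CondProb X, G.objective P Q ≤ G.objective P' Q

/-- The Lagrangian: multipliers `θ` for the source feature constraints, `lam` for the target group
marginal constraints. -/
def lagrangian (θ : Fin m → ℝ) (lam : Fin 2 → ℝ) (P Q : CondProb X) : EReal :=
  G.objective P Q +
    ((θ ⬝ᵥ (G.featMean Q - G.srcFeatMean) +
      ∑ k, lam k * (G.groupMean Q k - G.gtil k) : ℝ) : EReal)

/-- `(P, Q)` is in equilibrium given `θ` and `lam`: a saddle point of the Lagrangian over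
`Δ × Δ`. -/
def IsEquilibrium (θ : Fin m → ℝ) (lam : Fin 2 → ℝ) (P Q : CondProb X) : Prop :=
  (∀ Q' : CondProb X, G.lagrangian θ lam P Q' ≤ G.lagrangian θ lam P Q) ∧
    ∀ P' : CondProb X, G.lagrangian θ lam P Q ≤ G.lagrangian θ lam P' Q

/-- The Lagrangian dual function. -/
def dual (θ : Fin m → ℝ) (lam : Fin 2 → ℝ) : EReal :=
  ⨅ P : CondProb X, ⨆ Q : CondProb X, G.lagrangian θ lam P Q

/-- `θ` and `lam` are dual Lagrange multipliers: they solve the dual problem. -/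
def IsDualOptimal (θ : Fin m → ℝ) (lam : Fin 2 → ℝ) : Prop :=
  ∀ θ' lam', G.dual θ lam ≤ G.dual θ' lam'

/-- The left-hand side of the first-order equation for `P` at `z = (x, a)`; to be used only for
`0 < P(1 | x, a) < 1`. -/
def firstOrder (θ : Fin m → ℝ) (lam : Fin 2 → ℝ) (P : CondProb X) (z : X × Fin 2) : ℝ :=
  Real.log ((1 - P.prob z 1) / P.prob z 1)
    + G.mu * ∑ y', P.prob z y' * G.weight z.2 1 y'
    + G.ratio z * (θ ⬝ᵥ (G.feat z.1 1 - G.feat z.1 0))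
    + ∑ k, lam k * selector k z.2 1

/-- The range condition on `p = P(1 | x, a)`. -/
def InRange (a : Fin 2) (p : ℝ) : Prop :=
  if 1 < G.mu * G.weight a 1 1 then 0 < p ∧ p ≤ 1 / (G.mu * G.weight a 1 1)
  else 0 < p ∧ p < 1

/-- `P` solves the first-order equation, with the range condition, at target-almost every
covariate. -/
def Solves (θ : Fin m → ℝ) (lam : Fin 2 → ℝ) (P : CondProb X) : Prop :=
  ∀ᵐ z ∂G.trg, G.InRange z.2 (P.prob z 1) ∧ G.firstOrder θ lam P z = 0

/-- As `Solves`, but the left-hand side of the equation may be positive where `P(1 | x, a)` equals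
the upper end `1 / (μ f(a, 1, 1)) < 1` of its range (there the equation has no solution in the
range, and the constraint `Q ≤ 1` is active). -/
def SolvesTruncated (θ : Fin m → ℝ) (lam : Fin 2 → ℝ) (P : CondProb X) : Prop :=
  ∀ᵐ z ∂G.trg, G.InRange z.2 (P.prob z 1) ∧
    (G.firstOrder θ lam P z = 0 ∨
      (1 < G.mu * G.weight z.2 1 1 ∧ P.prob z 1 = 1 / (G.mu * G.weight z.2 1 1) ∧
        0 < G.firstOrder θ lam P z))

/-- The denominator of the adversary formula at `p = P(1 | x, a)`. -/
def advDenom (a : Fin 2) (p : ℝ) : ℝ :=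
  1 - G.mu * G.weight a 1 1 * p + G.mu * G.weight a 1 1 * p ^ 2

/-- `Q(1 | x, a)` is given by the adversary formula at target-almost every covariate. -/
def IsAdversaryOf (P Q : CondProb X) : Prop :=
  ∀ᵐ z ∂G.trg, Q.prob z 1 = P.prob z 1 / G.advDenom z.2 (P.prob z 1)

end Game

end FairShift

end

noncomputable section

namespace FairShift

/-! ### The game at a single covariate -/

/-- Expected log-loss of predicting label `1` with probability `p` if its probability is `q`. -/
def logCost (p q : ℝ) : ℝ := -(q * Real.log p) - (1 - q) * Real.log (1 - p)

/-- Integrand of the Lagrangian: log-loss, penalty of weight `c` and a tilt `h` of label `1`. -/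
def cost (c h p q : ℝ) : ℝ := logCost p q + c * q * p + q * h

/-- The derivative of `cost` in `q`. -/
def gap (c h p : ℝ) : ℝ := Real.log ((1 - p) / p) + c * p + h

/-- The range of predictions against which an adversary in `[0, 1]` can be in equilibrium. -/
def PredRange (c p : ℝ) : Prop := if 1 < c then 0 < p ∧ p ≤ 1 / c else 0 < p ∧ p < 1

/-- The truncated first-order equation at a single covariate. -/
def IsBalanced (c h p : ℝ) : Prop :=
  PredRange c p ∧ (gap c h p = 0 ∨ (1 < c ∧ p = 1 / c ∧ 0 < gap c h p))

/-- The adversary formula at a single covariate. -/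
def advProb (c p : ℝ) : ℝ := p / (1 - c * p + c * p ^ 2)

/-- The log-loss of the prediction `p` is finite if label `1` has probability `q`. -/
def FiniteLoss (p q : ℝ) : Prop := (p = 0 → q = 0) ∧ (p = 1 → q = 1)

theorem predRange_iff {c p : ℝ} : PredRange c p ↔ 0 < p ∧ p < 1 ∧ c * p ≤ 1 := by
  unfold PredRange
  split_ifs with hc
  · have hc0 : 0 < c := by linarith
    rw [le_div_iff₀ hc0]
    constructor
    · rintro ⟨h0, h1⟩
      exact ⟨h0, by nlinarith, by linarith⟩
    · rintro ⟨h0, -, h1⟩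
      exact ⟨h0, by linarith⟩
  · constructor
    · rintro ⟨h0, h1⟩
      exact ⟨h0, h1, by nlinarith⟩
    · rintro ⟨h0, h1, -⟩
      exact ⟨h0, h1⟩

theorem PredRange.denom_pos {c p : ℝ} (h : PredRange c p) : 0 < 1 - c * p + c * p ^ 2 := by
  obtain ⟨h0, h1, h2⟩ := predRange_iff.1 h
  nlinarith [mul_nonneg (sub_nonneg.2 h1.le) (sub_nonneg.2 h2)]

theorem predRange_iff_advProb {c p : ℝ} (h0 : 0 < p) (h1 : p < 1) :
    PredRange c p ↔
      1 - c * p + c * p ^ 2 ≠ 0 ∧ 0 ≤ advProb c p ∧ advProb c p ≤ 1 := by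
  constructor
  · intro h
    have hd := h.denom_pos
    obtain ⟨-, -, h2⟩ := predRange_iff.1 h
    refine ⟨hd.ne', div_nonneg h0.le hd.le, ?_⟩
    rw [advProb, div_le_one hd]
    nlinarith [mul_nonneg (sub_nonneg.2 h1.le) (sub_nonneg.2 h2)]
  · rintro ⟨hd, hq0, hq1⟩
    have hd' : 0 < 1 - c * p + c * p ^ 2 := by
      by_contra hneg
      have : 1 - c * p + c * p ^ 2 < 0 := lt_of_le_of_ne (not_lt.1 hneg) hd
      exact absurd hq0 (not_le.2 (div_neg_of_pos_of_neg h0 this))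
    rw [advProb, div_le_one hd'] at hq1
    refine predRange_iff.2 ⟨h0, h1, ?_⟩
    by_contra hc
    nlinarith [mul_pos (sub_pos.2 h1) (sub_pos.2 (not_le.1 hc))]

theorem PredRange.advProb_pos {c p : ℝ} (h : PredRange c p) : 0 < advProb c p :=
  div_pos (predRange_iff.1 h).1 h.denom_pos

theorem PredRange.advProb_le_one {c p : ℝ} (h : PredRange c p) : advProb c p ≤ 1 :=
  ((predRange_iff_advProb (predRange_iff.1 h).1 (predRange_iff.1 h).2.1).1 h).2.2

theorem advProb_eq_one {c : ℝ} (hc : 1 < c) : advProb c (1 / c) = 1 := by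
  have : c ≠ 0 := by linarith
  unfold advProb
  field_simp
  simp

theorem cost_sub_cost {c h p : ℝ} (h0 : 0 < p) (h1 : p < 1) (q q' : ℝ) :
    cost c h p q' - cost c h p q = (q' - q) * gap c h p := by
  rw [gap, Real.log_div (by linarith) h0.ne']
  unfold cost logCost
  ring

theorem IsBalanced.cost_le {c h p q : ℝ} (hb : IsBalanced c h p) (hq : q ≤ 1) :
    cost c h p q ≤ cost c h p (advProb c p) := by
  obtain ⟨h0, h1, -⟩ := predRange_iff.1 hb.1
  have := cost_sub_cost (c := c) (h := h) h0 h1 (advProb c p) q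
  rcases hb.2 with hg | ⟨hc, rfl, hg⟩
  · rw [hg, mul_zero] at this
    linarith
  · rw [advProb_eq_one hc] at this ⊢
    nlinarith

theorem PredRange.cost_lt {c h p p' : ℝ} (hr : PredRange c p) (h0' : 0 ≤ p') (h1' : p' ≤ 1)
    (hf : FiniteLoss p' (advProb c p)) (hne : p' ≠ p) :
    cost c h p (advProb c p) < cost c h p' (advProb c p) := by
  obtain ⟨h0, h1, -⟩ := predRange_iff.1 hr
  have hd := hr.denom_pos
  have hq0 := hr.advProb_pos
  have hq1 := hr.advProb_le_one
  have hfoc : p - advProb c p + c * advProb c p * p * (1 - p) = 0 := by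
    have : advProb c p * (1 - c * p + c * p ^ 2) = p := div_mul_cancel₀ _ hd.ne'
    linear_combination -this
  set q := advProb c p with hq
  have hp' : 0 < p' := lt_of_le_of_ne h0' fun h => hq0.ne' (hf.1 h.symm)
  have hlog : Real.log p' - Real.log p < (p' - p) / p := by
    have h2 : p' / p ≠ 1 := fun h => hne ((div_eq_one_iff_eq h0.ne').1 h)
    have := Real.log_lt_sub_one_of_pos (div_pos hp' h0) h2
    rw [Real.log_div hp'.ne' h0.ne'] at this
    rwa [sub_div, div_self h0.ne']
  have hlog' : (1 - q) * (Real.log (1 - p') - Real.log (1 - p)) ≤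
      (1 - q) * (-(p' - p) / (1 - p)) := by
    rcases hq1.eq_or_lt with hq1 | hq1
    · simp [hq1]
    · have hp1 : p' < 1 := lt_of_le_of_ne h1' fun h => hq1.ne (hf.2 h)
      refine mul_le_mul_of_nonneg_left ?_ (by linarith)
      have := Real.log_le_sub_one_of_pos (div_pos (sub_pos.2 hp1) (sub_pos.2 h1))
      rw [Real.log_div (by linarith) (by linarith)] at this
      refine this.trans (le_of_eq ?_)
      have : 1 - p ≠ 0 := by linarith
      field_simp
      ring
  have hlin : -(q * ((p' - p) / p)) - (1 - q) * (-(p' - p) / (1 - p)) + c * q * (p' - p) = 0 := by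
    have : 1 - p ≠ 0 := by linarith
    field_simp
    linear_combination (p' - p) * hfoc
  have := mul_lt_mul_of_pos_left hlog hq0
  unfold cost logCost
  nlinarith

theorem PredRange.cost_le {c h p p' : ℝ} (hr : PredRange c p) (h0' : 0 ≤ p') (h1' : p' ≤ 1)
    (hf : FiniteLoss p' (advProb c p)) :
    cost c h p (advProb c p) ≤ cost c h p' (advProb c p) := by
  rcases eq_or_ne p' p with rfl | hne
  · exact le_rfl
  · exact (hr.cost_lt h0' h1' hf hne).le

theorem sub_le_gap_sub_gap {c h p p' : ℝ} (h0 : 0 < p) (hp : p ≤ p') (h1 : p' < 1)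
    (hc : c * p' ≤ 1) : p' - p ≤ gap c h p - gap c h p' := by
  have h0' : 0 < p' := by linarith
  have e1 := Real.one_sub_inv_le_log_of_pos (div_pos h0' h0)
  have e2 := Real.one_sub_inv_le_log_of_pos (div_pos (sub_pos.2 (hp.trans_lt h1)) (sub_pos.2 h1))
  rw [Real.log_div h0'.ne' h0.ne', inv_div] at e1
  rw [Real.log_div (by linarith) (by linarith), inv_div] at e2
  have e3 : c * (p' - p) ≤ 1 - p / p' := by
    rw [one_sub_div h0'.ne', le_div_iff₀ h0']
    nlinarith
  have e4 : p' - p ≤ 1 - (1 - p') / (1 - p) := by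
    rw [one_sub_div (by linarith), le_div_iff₀ (by linarith)]
    nlinarith
  unfold gap
  rw [Real.log_div (by linarith) h0.ne', Real.log_div (by linarith) h0'.ne']
  linarith

theorem IsBalanced.gap_nonneg {c h p : ℝ} (hb : IsBalanced c h p) : 0 ≤ gap c h p := by
  rcases hb.2 with h | h
  · exact h.ge
  · exact h.2.2.le

theorem IsBalanced.gap_eq_zero_of_lt {c h h' p p' : ℝ} (hb : IsBalanced c h p)
    (hb' : IsBalanced c h' p') (hlt : p < p') : gap c h p = 0 := by
  rcases hb.2 with h | ⟨hc, rfl, -⟩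
  · exact h
  · have := hb'.1
    rw [PredRange, if_pos hc] at this
    exact absurd hlt (not_lt.2 this.2)

theorem gap_shift (c h h' p : ℝ) : gap c h' p = gap c h p + (h' - h) := by
  unfold gap; ring

/-- Solutions of the truncated equation are monotone and nonexpansive in the tilt. -/
theorem IsBalanced.sub_mem {c h h' p p' : ℝ} (hb : IsBalanced c h p) (hb' : IsBalanced c h' p')
    (hh : h ≤ h') : 0 ≤ p' - p ∧ p' - p ≤ h' - h := by
  obtain ⟨h0, h1, h2⟩ := predRange_iff.1 hb.1
  obtain ⟨h0', h1', h2'⟩ := predRange_iff.1 hb'.1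
  have e := gap_shift c h h' p
  have e' := gap_shift c h h' p'
  have g := hb.gap_nonneg
  have g' := hb'.gap_nonneg
  rcases lt_trichotomy p p' with hlt | rfl | hlt
  · have := hb.gap_eq_zero_of_lt hb' hlt
    have := sub_le_gap_sub_gap (h := h) h0 hlt.le h1' h2'
    exact ⟨by linarith, by linarith⟩
  · simp [hh]
  · have := hb'.gap_eq_zero_of_lt hb hlt
    have := sub_le_gap_sub_gap (h := h) h0' hlt.le h1 h2
    linarith

theorem IsBalanced.abs_sub_le {c h h' p p' : ℝ} (hb : IsBalanced c h p)
    (hb' : IsBalanced c h' p') : |p' - p| ≤ |h' - h| := by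
  rcases le_total h h' with hh | hh
  · have := hb.sub_mem hb' hh
    rw [abs_of_nonneg this.1, abs_of_nonneg (by linarith)]
    exact this.2
  · have := hb'.sub_mem hb hh
    rw [abs_sub_comm, abs_sub_comm h', abs_of_nonneg this.1, abs_of_nonneg (by linarith)]
    exact this.2

theorem IsBalanced.unique {c h p p' : ℝ} (hb : IsBalanced c h p) (hb' : IsBalanced c h p') :
    p' = p := by
  have := hb.abs_sub_le hb'
  rw [sub_self, abs_zero] at this
  exact sub_eq_zero.1 (abs_nonpos_iff.1 this)

theorem gap_sigmoid (c h s : ℝ) :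
    gap c h (1 / (1 + Real.exp s)) = s + c * (1 / (1 + Real.exp s)) + h := by
  have hs := Real.exp_pos s
  have : (1 - 1 / (1 + Real.exp s)) / (1 / (1 + Real.exp s)) = Real.exp s := by
    field_simp
    ring
  rw [gap, this, Real.log_exp]

theorem exists_gap_eq_zero {c h p₀ p₁ : ℝ} (h0 : 0 < p₀) (hp : p₀ ≤ p₁) (h1 : p₁ < 1)
    (g0 : 0 ≤ gap c h p₀) (g1 : gap c h p₁ ≤ 0) :
    ∃ p, p₀ ≤ p ∧ p ≤ p₁ ∧ gap c h p = 0 := by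
  have hcont : ContinuousOn (gap c h) (Set.Icc p₀ p₁) := by
    intro x hx
    have hx0 : x ≠ 0 := by linarith [hx.1]
    have hx1 : (1 - x) / x ≠ 0 := div_ne_zero (by linarith [hx.2]) hx0
    unfold gap
    exact ContinuousAt.continuousWithinAt (by fun_prop (disch := assumption))
  obtain ⟨p, hp, hz⟩ := intermediate_value_Icc' hp hcont ⟨g1, g0⟩
  exact ⟨p, hp.1, hp.2, hz⟩

theorem exists_isBalanced (c h : ℝ) : ∃ p, IsBalanced c h p := by
  set s := |c| + |h| with hs
  have hs0 : 0 ≤ s := by positivity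
  have hsig : ∀ t, 0 < 1 / (1 + Real.exp t) ∧ 1 / (1 + Real.exp t) < 1 := fun t => by
    have := Real.exp_pos t
    exact ⟨by positivity, by rw [div_lt_one (by positivity)]; linarith⟩
  have hbound : ∀ t, |c * (1 / (1 + Real.exp t))| ≤ |c| := fun t => by
    rw [abs_mul, abs_of_pos (hsig t).1]
    nlinarith [abs_nonneg c, (hsig t).2]
  have g0 : 0 ≤ gap c h (1 / (1 + Real.exp s)) := by
    rw [gap_sigmoid]
    linarith [neg_abs_le (c * (1 / (1 + Real.exp s))), neg_abs_le h, hbound s]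
  by_cases hc : 1 < c
  · have hc0 : 0 < c := by linarith
    by_cases hg : 0 < gap c h (1 / c)
    · refine ⟨1 / c, ?_, Or.inr ⟨hc, rfl, hg⟩⟩
      rw [PredRange, if_pos hc]
      exact ⟨by positivity, le_rfl⟩
    · have hle : 1 / (1 + Real.exp s) ≤ 1 / c := by
        apply one_div_le_one_div_of_le hc0
        linarith [Real.add_one_le_exp s, le_abs_self c, abs_nonneg h]
      obtain ⟨p, hp0, hp1, hp⟩ := exists_gap_eq_zero (hsig s).1 hle
        ((div_lt_one hc0).2 hc) g0 (not_lt.1 hg)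
      refine ⟨p, ?_, Or.inl hp⟩
      rw [PredRange, if_pos hc]
      exact ⟨(hsig s).1.trans_le hp0, hp1⟩
  · have g1 : gap c h (1 / (1 + Real.exp (-s))) ≤ 0 := by
      rw [gap_sigmoid]
      linarith [le_abs_self (c * (1 / (1 + Real.exp (-s)))), le_abs_self h, hbound (-s)]
    have hle : 1 / (1 + Real.exp s) ≤ 1 / (1 + Real.exp (-s)) := by
      apply one_div_le_one_div_of_le (by positivity)
      have : Real.exp (-s) ≤ Real.exp s := Real.exp_le_exp.2 (by linarith)
      linarith
    obtain ⟨p, hp0, hp1, hp⟩ := exists_gap_eq_zero (hsig s).1 hle (hsig (-s)).2 g0 g1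
    refine ⟨p, ?_, Or.inl hp⟩
    rw [PredRange, if_neg hc]
    exact ⟨(hsig s).1.trans_le hp0, hp1.trans_lt (hsig (-s)).2⟩

/-- The solution of the truncated equation. -/
def robustProb (c h : ℝ) : ℝ := (exists_isBalanced c h).choose

theorem isBalanced_robustProb (c h : ℝ) : IsBalanced c h (robustProb c h) :=
  (exists_isBalanced c h).choose_spec

theorem robustProb_abs_sub_le (c h h' : ℝ) :
    |robustProb c h' - robustProb c h| ≤ |h' - h| :=
  (isBalanced_robustProb c h).abs_sub_le (isBalanced_robustProb c h')

theorem continuous_robustProb (c : ℝ) : Continuous (robustProb c) := by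
  refine (LipschitzWith.of_dist_le_mul (K := 1) fun x y => ?_).continuous
  simpa [Real.dist_eq] using robustProb_abs_sub_le c y x

theorem continuous_advProb_robustProb (c : ℝ) :
    Continuous fun h => advProb c (robustProb c h) := by
  have := continuous_robustProb c
  unfold advProb
  exact this.div (by fun_prop) fun h => (isBalanced_robustProb c h).1.denom_pos.ne'

/-- The value of the game at a single covariate. -/
def gameValue (c h : ℝ) : ℝ := cost c h (robustProb c h) (advProb c (robustProb c h))

theorem FiniteLoss.of_mem {p : ℝ} (q : ℝ) (h0 : 0 < p) (h1 : p < 1) : FiniteLoss p q :=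
  ⟨fun h => absurd h h0.ne', fun h => absurd h h1.ne⟩

theorem PredRange.finiteLoss {c p : ℝ} (h : PredRange c p) (q : ℝ) : FiniteLoss p q :=
  .of_mem q (predRange_iff.1 h).1 (predRange_iff.1 h).2.1

theorem gameValue_sub_le (c h h' : ℝ) : gameValue c h - gameValue c h' ≤ |h - h'| := by
  have hb := isBalanced_robustProb c h
  have hb' := isBalanced_robustProb c h'
  obtain ⟨h0', h1', -⟩ := predRange_iff.1 hb'.1
  set q := advProb c (robustProb c h) with hq
  have e1 : gameValue c h ≤ cost c h (robustProb c h') q :=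
    hb.1.cost_le h0'.le h1'.le (hb'.1.finiteLoss _)
  have e2 : cost c h' (robustProb c h') q ≤ gameValue c h' := hb'.cost_le hb.1.advProb_le_one
  have e3 : cost c h (robustProb c h') q - cost c h' (robustProb c h') q = q * (h - h') := by
    unfold cost
    ring
  have e4 : q * (h - h') ≤ |h - h'| := by
    nlinarith [le_abs_self (h - h'), abs_nonneg (h - h'), hb.1.advProb_le_one, hb.1.advProb_pos]
  linarith

theorem abs_gameValue_sub_le (c h h' : ℝ) : |gameValue c h - gameValue c h'| ≤ |h - h'| :=
  abs_sub_le_iff.2 ⟨gameValue_sub_le c h h', abs_sub_comm h h' ▸ gameValue_sub_le c h' h⟩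

theorem continuous_gameValue (c : ℝ) : Continuous (gameValue c) := by
  refine (LipschitzWith.of_dist_le_mul (K := 1) fun x y => ?_).continuous
  simpa [Real.dist_eq] using abs_gameValue_sub_le c x y

theorem max_zero_sub_le_gameValue (c h : ℝ) : max 0 h - |c| ≤ gameValue c h := by
  have hb := isBalanced_robustProb c h
  obtain ⟨h0, h1, -⟩ := predRange_iff.1 hb.1
  have e0 := hb.cost_le zero_le_one
  have e1 := hb.cost_le le_rfl
  have l0 := Real.log_nonpos (sub_nonneg.2 h1.le) (by linarith)
  have l1 := Real.log_nonpos h0.le h1.le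
  have hcp : -|c| ≤ c * robustProb c h := by
    nlinarith [neg_abs_le c, abs_nonneg c]
  unfold gameValue
  rcases max_cases 0 h with hm | hm <;> rw [hm.1]
  · refine le_trans ?_ e0
    unfold cost logCost
    linarith [abs_nonneg c]
  · refine le_trans ?_ e1
    unfold cost logCost
    linarith

/-- Bound for the logarithms of solutions of the truncated equation. -/
def logBound (c : ℝ) : ℝ :=
  Real.log 2 + |c| + |Real.log (1 / c)| + |Real.log (1 - 1 / c)|

theorem IsBalanced.abs_log_le {c h p : ℝ} (hb : IsBalanced c h p) :
    |Real.log p| ≤ logBound c + |h| ∧ |Real.log (1 - p)| ≤ logBound c + |h| := by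
  obtain ⟨h0, h1, -⟩ := predRange_iff.1 hb.1
  have l2 : 0 ≤ Real.log 2 := Real.log_nonneg (by norm_num)
  unfold logBound
  have a1 := abs_nonneg c
  have a2 := abs_nonneg h
  have a3 := abs_nonneg (Real.log (1 / c))
  have a4 := abs_nonneg (Real.log (1 - 1 / c))
  rcases hb.2 with hg | ⟨hc, rfl, -⟩
  · have l0 := Real.log_nonpos (sub_nonneg.2 h1.le) (by linarith)
    have l1 := Real.log_nonpos h0.le h1.le
    rw [abs_of_nonpos l0, abs_of_nonpos l1]
    rw [gap, Real.log_div (by linarith) h0.ne'] at hg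
    have hcp : |c * p| ≤ |c| := by
      rw [abs_mul, abs_of_pos h0]
      nlinarith
    have hcp1 := le_abs_self (c * p)
    have hcp2 := neg_abs_le (c * p)
    have hh1 := le_abs_self h
    have hh2 := neg_abs_le h
    have hmin : -Real.log 2 ≤ Real.log p ∨ -Real.log 2 ≤ Real.log (1 - p) := by
      rw [← Real.log_inv]
      rcases le_total (2⁻¹) p with hp | hp
      · exact Or.inl (Real.log_le_log (by norm_num) hp)
      · exact Or.inr (Real.log_le_log (by norm_num) (by linarith))
    rcases hmin with hm | hm <;> constructor <;> linarith
  · constructor <;> linarith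

theorem abs_logCost_le {p q : ℝ} (h0 : 0 ≤ q) (h1 : q ≤ 1) :
    |logCost p q| ≤ |Real.log p| + |Real.log (1 - p)| := by
  unfold logCost
  refine (abs_sub _ _).trans ?_
  rw [abs_neg, abs_mul, abs_mul, abs_of_nonneg h0, abs_of_nonneg (sub_nonneg.2 h1)]
  nlinarith [abs_nonneg (Real.log p), abs_nonneg (Real.log (1 - p))]

theorem hasDerivAt_cost {c h p : ℝ} (h0 : 0 < p) (h1 : p < 1) (q : ℝ) :
    HasDerivAt (fun r => cost c h r q) (-(q / p) + (1 - q) / (1 - p) + c * q) p := by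
  have e1 := (Real.hasDerivAt_log h0.ne').const_mul q
  have e2 := (((hasDerivAt_id p).const_sub 1).log (sub_ne_zero.2 h1.ne')).const_mul (1 - q)
  have e3 := (hasDerivAt_id p).const_mul (c * q)
  refine HasDerivAt.congr_deriv (f := fun r => cost c h r q)
    (((e1.neg.sub e2).add e3).add_const (q * h)) ?_
  simp only [id]
  ring

/-- The adversary formula is the first-order condition for `p`. -/
theorem PredRange.eq_advProb {c h p q : ℝ} (hr : PredRange c p)
    (hmin : ∀ r : ℚ, 0 < (r : ℝ) → (r : ℝ) < 1 → cost c h p q ≤ cost c h r q) :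
    q = advProb c p := by
  obtain ⟨h0, h1, -⟩ := predRange_iff.1 hr
  have hall : ∀ x ∈ Set.Ioo (0 : ℝ) 1, cost c h p q ≤ cost c h x q := by
    intro x hx
    by_contra hlt
    have hev := (hasDerivAt_cost (c := c) (h := h) hx.1 hx.2 q).continuousAt.eventually
      (gt_mem_nhds (not_le.1 hlt))
    have hev' := hev.and (Ioo_mem_nhds hx.1 hx.2)
    obtain ⟨l, u, hlu, hsub⟩ := mem_nhds_iff_exists_Ioo_subset.1 hev'
    obtain ⟨r, hr1, hr2⟩ := exists_rat_btwn (hlu.1.trans hlu.2)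
    have hr := hsub ⟨hr1, hr2⟩
    exact absurd (hmin r hr.2.1 hr.2.2) (not_le.2 hr.1)
  have hloc : IsLocalMin (fun r => cost c h r q) p :=
    Filter.mem_of_superset (Ioo_mem_nhds h0 h1) hall
  have hd := hloc.hasDerivAt_eq_zero (hasDerivAt_cost h0 h1 q)
  have hden := hr.denom_pos
  have h1' : 1 - p ≠ 0 := by linarith
  rw [advProb, eq_div_iff hden.ne']
  field_simp at hd
  linear_combination -hd

theorem logLoss_of_ne_zero {p : ℝ} (hp : p ≠ 0) : logLoss p = ENNReal.ofReal (-Real.log p) :=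
  if_neg hp

theorem logLoss_zero : logLoss 0 = ⊤ := if_pos rfl

theorem measurable_logLoss : Measurable logLoss :=
  Measurable.ite (measurableSet_singleton 0) measurable_const (by fun_prop)

theorem logCost_nonneg {p q : ℝ} (hp0 : 0 ≤ p) (hp1 : p ≤ 1) (hq0 : 0 ≤ q) (hq1 : q ≤ 1) :
    0 ≤ logCost p q := by
  have l0 := Real.log_nonpos (sub_nonneg.2 hp1) (by linarith)
  have l1 := Real.log_nonpos hp0 hp1
  unfold logCost
  nlinarith

theorem FiniteLoss.loss_eq {p q : ℝ} (hf : FiniteLoss p q) (hp0 : 0 ≤ p) (hp1 : p ≤ 1)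
    (hq0 : 0 ≤ q) (hq1 : q ≤ 1) :
    ENNReal.ofReal (1 - q) * logLoss (1 - p) + ENNReal.ofReal q * logLoss p =
      ENNReal.ofReal (logCost p q) := by
  by_cases h0 : p = 0
  · rw [h0, hf.1 h0]
    simp [logCost, logLoss]
  by_cases h1 : p = 1
  · rw [h1, hf.2 h1]
    simp [logCost, logLoss]
  have l0 := Real.log_nonpos (sub_nonneg.2 hp1) (by linarith)
  have l1 := Real.log_nonpos hp0 hp1
  rw [logLoss_of_ne_zero h0, logLoss_of_ne_zero (sub_ne_zero.2 (Ne.symm h1)),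
    ← ENNReal.ofReal_mul (by linarith), ← ENNReal.ofReal_mul hq0,
    ← ENNReal.ofReal_add (by nlinarith) (by nlinarith), logCost]
  congr 1
  ring

theorem loss_eq_top {p q : ℝ} (hf : ¬ FiniteLoss p q) (hq0 : 0 ≤ q) (hq1 : q ≤ 1) :
    ENNReal.ofReal (1 - q) * logLoss (1 - p) + ENNReal.ofReal q * logLoss p = ⊤ := by
  by_cases h0 : p = 0 → q = 0
  · have h1 : p = 1 ∧ q ≠ 1 := by
      by_contra h
      exact hf ⟨h0, fun h1 => by_contra fun h2 => h ⟨h1, h2⟩⟩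
    have : 0 < 1 - q := sub_pos.2 (lt_of_le_of_ne hq1 h1.2)
    rw [h1.1, sub_self, logLoss_zero, ENNReal.mul_top (by simpa using this), top_add]
  · push Not at h0
    have : 0 < q := lt_of_le_of_ne hq0 (Ne.symm h0.2)
    rw [h0.1, logLoss_zero, ENNReal.mul_top (by simpa using this), add_top]

namespace CondProb

variable {X : Type*} [MeasurableSpace X]

theorem prob_zero (P : CondProb X) (z : X × Fin 2) : P.prob z 0 = 1 - P.prob z 1 := by
  have := P.sum_eq_one z
  rw [Fin.sum_univ_two] at this
  linarith

theorem prob_le_one (P : CondProb X) (z : X × Fin 2) : P.prob z 1 ≤ 1 := by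
  have := P.prob_zero z
  linarith [P.nonneg z 0]

/-- The conditional distribution whose probability of label `1` is `f`, clamped to `[0, 1]`. -/
def clamp (f : X × Fin 2 → ℝ) (hf : Measurable f) : CondProb X where
  prob z y := if y = 1 then max 0 (min 1 (f z)) else 1 - max 0 (min 1 (f z))
  nonneg z y := by
    split_ifs
    · exact le_max_left _ _
    · exact sub_nonneg.2 (max_le zero_le_one (min_le_left _ _))
  sum_eq_one z := by simp [Fin.sum_univ_two]
  measurable y := by
    split_ifs <;> fun_prop

theorem clamp_prob {f : X × Fin 2 → ℝ} (hf : Measurable f) {z : X × Fin 2} (h0 : 0 ≤ f z)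
    (h1 : f z ≤ 1) : (clamp f hf).prob z 1 = f z := by
  simp [clamp, h0, h1]

theorem measurable_one (P : CondProb X) : Measurable fun z => P.prob z 1 := P.measurable 1

theorem integrable_mul (P : CondProb X) {ν : Measure (X × Fin 2)} {f : X × Fin 2 → ℝ}
    (hf : Integrable f ν) : Integrable (fun z => P.prob z 1 * f z) ν := by
  refine hf.bdd_mul (c := 1) P.measurable_one.aestronglyMeasurable (.of_forall fun z => ?_)
  rw [Real.norm_eq_abs, abs_of_nonneg (P.nonneg z 1)]
  exact P.prob_le_one z

end CondProb

theorem dotProduct_integral {Z : Type*} [MeasurableSpace Z] {ν : Measure Z} {m : ℕ}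
    (θ : Fin m → ℝ) {f : Z → Fin m → ℝ} (hf : Integrable f ν) :
    θ ⬝ᵥ (∫ z, f z ∂ν) = ∫ z, θ ⬝ᵥ f z ∂ν := by
  unfold dotProduct
  rw [integral_finsetSum _ fun i _ => (hf.eval i).const_mul _]
  exact Finset.sum_congr rfl fun i _ => by
    rw [eval_integral fun i => hf.eval i, integral_const_mul]

theorem integrable_dotProduct {Z : Type*} [MeasurableSpace Z] {ν : Measure Z} {m : ℕ}
    (θ : Fin m → ℝ) {f : Z → Fin m → ℝ} (hf : Integrable f ν) :
    Integrable (fun z => θ ⬝ᵥ f z) ν :=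
  integrable_finsetSum _ fun i _ => (hf.eval i).const_mul _

theorem integrable_comp_snd {X : Type*} [MeasurableSpace X] (ν : Measure (X × Fin 2))
    [IsFiniteMeasure ν] (g : Fin 2 → ℝ) : Integrable (fun z => g z.2) ν :=
  (Integrable.of_finite (f := g)).comp_measurable measurable_snd

namespace Game

variable {X : Type*} [MeasurableSpace X] {m : ℕ} {G : Game X m}

/-- The standing assumptions on the distributions and features. -/
structure IsRegular (G : Game X m) : Prop where
  src : IsProbabilityMeasure G.src
  trg : IsProbabilityMeasure G.trg
  ac : G.srcXA ≪ G.trg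
  feat : ∀ y : Fin 2, Integrable (fun z : X × Fin 2 => G.feat z.1 y) G.srcXA

variable (G) in
/-- The penalty weight of group `a`. -/
def penalty (a : Fin 2) : ℝ := G.mu * G.weight a 1 1

variable (G) in
/-- The coefficient of `Q(1 | x, a)` in the multiplier terms of the Lagrangian. -/
def tilt (θ : Fin m → ℝ) (lam : Fin 2 → ℝ) (z : X × Fin 2) : ℝ :=
  G.ratio z * (θ ⬝ᵥ (G.feat z.1 1 - G.feat z.1 0)) + ∑ k, lam k * selector k z.2 1

variable (G) in
/-- The part of the multiplier terms of the Lagrangian which does not depend on `Q`. -/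
def shift (θ : Fin m → ℝ) (lam : Fin 2 → ℝ) : ℝ :=
  θ ⬝ᵥ (∫ z, G.feat z.1 0 ∂G.srcXA) - θ ⬝ᵥ G.srcFeatMean - ∑ k, lam k * G.gtil k

variable (G) in
/-- The multiplier terms of the Lagrangian. -/
def violation (θ : Fin m → ℝ) (lam : Fin 2 → ℝ) (Q : CondProb X) : ℝ :=
  θ ⬝ᵥ (G.featMean Q - G.srcFeatMean) + ∑ k, lam k * (G.groupMean Q k - G.gtil k)

theorem feasible_iff_violation {Q : CondProb X} :
    G.Feasible Q ↔ ∀ θ lam, G.violation θ lam Q = 0 := by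
  constructor
  · rintro ⟨h1, h2⟩ θ lam
    simp [violation, h1, h2]
  · intro h
    refine ⟨funext fun i => ?_, fun k => ?_⟩
    · have := h (Pi.single i 1) 0
      simp only [violation, single_dotProduct, Pi.zero_apply, zero_mul, Finset.sum_const_zero,
        add_zero, one_mul, Pi.sub_apply] at this
      exact sub_eq_zero.1 this
    · have := h 0 (Pi.single k 1)
      simp only [violation, zero_dotProduct, zero_add, Pi.single_apply, ite_mul, one_mul, zero_mul,
        Finset.sum_ite_eq', Finset.mem_univ, if_true] at this
      exact sub_eq_zero.1 this

theorem weight_zero_left (a y : Fin 2) : G.weight a 0 y = 0 := by simp [weight]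

theorem weight_zero_right (a y : Fin 2) : G.weight a y 0 = 0 := by simp [weight]

theorem selector_zero (k a : Fin 2) : selector k a 0 = 0 := by simp [selector]

theorem firstOrder_eq_gap (θ : Fin m → ℝ) (lam : Fin 2 → ℝ) (P : CondProb X) (z : X × Fin 2) :
    G.firstOrder θ lam P z = gap (G.penalty z.2) (G.tilt θ lam z) (P.prob z 1) := by
  simp only [firstOrder, gap, tilt, penalty, Fin.sum_univ_two (f := fun y' => P.prob z y' * _),
    weight_zero_right]
  ring

theorem solvesTruncated_iff {θ : Fin m → ℝ} {lam : Fin 2 → ℝ} {P : CondProb X} :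
    G.SolvesTruncated θ lam P ↔
      ∀ᵐ z ∂G.trg, IsBalanced (G.penalty z.2) (G.tilt θ lam z) (P.prob z 1) := by
  simp only [SolvesTruncated, firstOrder_eq_gap]
  rfl

theorem Solves.solvesTruncated {θ : Fin m → ℝ} {lam : Fin 2 → ℝ} {P : CondProb X}
    (h : G.Solves θ lam P) : G.SolvesTruncated θ lam P :=
  h.mono fun _ hz => ⟨hz.1, Or.inl hz.2⟩

theorem isAdversaryOf_iff {P Q : CondProb X} :
    G.IsAdversaryOf P Q ↔ ∀ᵐ z ∂G.trg, Q.prob z 1 = advProb (G.penalty z.2) (P.prob z 1) :=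
  Iff.rfl

theorem fairPenalty_eq (P Q : CondProb X) :
    G.mu * G.fairPenalty P Q =
      ∫ z, Q.prob z 1 * (P.prob z 1 * G.penalty z.2) ∂G.trg := by
  rw [fairPenalty, ← integral_const_mul]
  congr 1 with z
  simp only [Fin.sum_univ_two, weight_zero_left, weight_zero_right, penalty]
  ring

theorem IsRegular.srcXA (hG : G.IsRegular) : IsProbabilityMeasure G.srcXA :=
  have := hG.src
  Measure.isProbabilityMeasure_map (by fun_prop)

theorem IsRegular.integrable_tilt (hG : G.IsRegular) (θ : Fin m → ℝ) (lam : Fin 2 → ℝ) :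
    Integrable (G.tilt θ lam) G.trg := by
  have := hG.srcXA
  have := hG.trg
  refine Integrable.add ?_ (integrable_comp_snd G.trg fun a => ∑ k, lam k * selector k a 1)
  exact (integrable_rnDeriv_smul_iff hG.ac).2
    (integrable_dotProduct θ ((hG.feat 1).sub (hG.feat 0)))

theorem groupMean_eq (Q : CondProb X) (k : Fin 2) :
    G.groupMean Q k = ∫ z, Q.prob z 1 * selector k z.2 1 ∂G.trg := by
  simp only [groupMean, Fin.sum_univ_two, selector_zero, mul_zero, zero_add]

theorem IsRegular.violation_eq (hG : G.IsRegular) (θ : Fin m → ℝ) (lam : Fin 2 → ℝ)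
    (Q : CondProb X) :
    G.violation θ lam Q = ∫ z, Q.prob z 1 * G.tilt θ lam z ∂G.trg + G.shift θ lam := by
  have := hG.srcXA
  have := hG.trg
  have hd : Integrable (fun z : X × Fin 2 => θ ⬝ᵥ (G.feat z.1 1 - G.feat z.1 0)) G.srcXA :=
    integrable_dotProduct θ ((hG.feat 1).sub (hG.feat 0))
  have hQ : ∀ y, Integrable (fun z => Q.prob z y • G.feat z.1 y) G.srcXA := by
    intro y
    refine (hG.feat y).bdd_smul (C := 1) (Q.measurable y).aestronglyMeasurable
      (.of_forall fun z => ?_)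
    rw [Real.norm_eq_abs, abs_of_nonneg (Q.nonneg z y)]
    have := Q.sum_eq_one z
    rw [← this]
    exact Finset.single_le_sum (fun i _ => Q.nonneg z i) (Finset.mem_univ y)
  have e1 : θ ⬝ᵥ G.featMean Q = θ ⬝ᵥ (∫ z, G.feat z.1 0 ∂G.srcXA) +
      ∫ z, Q.prob z 1 * (G.ratio z * (θ ⬝ᵥ (G.feat z.1 1 - G.feat z.1 0))) ∂G.trg := by
    rw [featMean, dotProduct_integral θ (integrable_finsetSum _ fun y _ => hQ y),
      dotProduct_integral θ (hG.feat 0)]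
    have e2 : ∫ z, Q.prob z 1 * (G.ratio z * (θ ⬝ᵥ (G.feat z.1 1 - G.feat z.1 0))) ∂G.trg =
        ∫ z, Q.prob z 1 * (θ ⬝ᵥ (G.feat z.1 1 - G.feat z.1 0)) ∂G.srcXA := by
      rw [← integral_toReal_rnDeriv_mul hG.ac]
      congr 1 with z
      unfold ratio
      ring
    rw [e2, ← integral_add (integrable_dotProduct θ (hG.feat 0)) (Q.integrable_mul hd)]
    congr 1 with z
    rw [Fin.sum_univ_two, Q.prob_zero, dotProduct_add, dotProduct_smul, dotProduct_smul,
      dotProduct_sub, smul_eq_mul, smul_eq_mul]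
    ring
  have e3 : ∫ z, Q.prob z 1 * G.tilt θ lam z ∂G.trg =
      ∫ z, Q.prob z 1 * (G.ratio z * (θ ⬝ᵥ (G.feat z.1 1 - G.feat z.1 0))) ∂G.trg +
        ∑ k, lam k * G.groupMean Q k := by
    have hs : ∀ k, Integrable (fun z => lam k * (Q.prob z 1 * selector k z.2 1)) G.trg :=
      fun k => (Q.integrable_mul (integrable_comp_snd G.trg fun a => selector k a 1)).const_mul _
    simp only [groupMean_eq, ← integral_const_mul]
    rw [← integral_finsetSum _ fun k _ => hs k, ← integral_add ?_
      (integrable_finsetSum _ fun k _ => hs k)]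
    · congr 1 with z
      rw [tilt, mul_add, Finset.mul_sum]
      congr 1
      exact Finset.sum_congr rfl fun k _ => by ring
    · exact Q.integrable_mul ((integrable_rnDeriv_smul_iff hG.ac).2 hd)
  rw [violation, shift, e3, dotProduct_sub, e1]
  simp only [mul_sub, Finset.sum_sub_distrib]
  ring

variable (G) in
/-- The expected log-loss of `P` under `Q` is finite. -/
def LossFinite (P Q : CondProb X) : Prop :=
  (∀ᵐ z ∂G.trg, FiniteLoss (P.prob z 1) (Q.prob z 1)) ∧
    Integrable (fun z => logCost (P.prob z 1) (Q.prob z 1)) G.trg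

theorem measurable_logCost (P Q : CondProb X) :
    Measurable fun z => logCost (P.prob z 1) (Q.prob z 1) := by
  have := P.measurable_one
  have := Q.measurable_one
  unfold logCost
  fun_prop

theorem logCost_prob_nonneg (P Q : CondProb X) (z : X × Fin 2) :
    0 ≤ logCost (P.prob z 1) (Q.prob z 1) :=
  logCost_nonneg (P.nonneg z 1) (P.prob_le_one z) (Q.nonneg z 1) (Q.prob_le_one z)

theorem expLogLoss_eq_lintegral (P Q : CondProb X) :
    G.expLogLoss P Q = ∫⁻ z, (ENNReal.ofReal (1 - Q.prob z 1) * logLoss (1 - P.prob z 1) +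
      ENNReal.ofReal (Q.prob z 1) * logLoss (P.prob z 1)) ∂G.trg := by
  simp only [expLogLoss, Fin.sum_univ_two, CondProb.prob_zero]

theorem lintegral_loss_eq {P Q : CondProb X}
    (h : ∀ᵐ z ∂G.trg, FiniteLoss (P.prob z 1) (Q.prob z 1)) :
    G.expLogLoss P Q =
      ∫⁻ z, ENNReal.ofReal (logCost (P.prob z 1) (Q.prob z 1)) ∂G.trg := by
  rw [expLogLoss_eq_lintegral]
  exact lintegral_congr_ae (h.mono fun z hz =>
    hz.loss_eq (P.nonneg z 1) (P.prob_le_one z) (Q.nonneg z 1) (Q.prob_le_one z))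

theorem LossFinite.expLogLoss_eq {P Q : CondProb X} (h : G.LossFinite P Q) :
    G.expLogLoss P Q =
      ENNReal.ofReal (∫ z, logCost (P.prob z 1) (Q.prob z 1) ∂G.trg) := by
  rw [lintegral_loss_eq h.1, ofReal_integral_eq_lintegral_ofReal h.2
    (.of_forall (logCost_prob_nonneg P Q))]

theorem expLogLoss_eq_top {P Q : CondProb X} (h : ¬ G.LossFinite P Q) :
    G.expLogLoss P Q = ⊤ := by
  by_contra hne
  refine h ?_
  have hfin : ∀ᵐ z ∂G.trg, FiniteLoss (P.prob z 1) (Q.prob z 1) := by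
    rw [expLogLoss_eq_lintegral] at hne
    have hP := P.measurable_one
    have hQ := Q.measurable_one
    have hP1 := measurable_logLoss.comp hP
    have hP0 := measurable_logLoss.comp (hP.const_sub 1)
    refine (ae_lt_top ?_ hne).mono fun z hz => ?_
    · exact ((hQ.const_sub 1).ennreal_ofReal.mul hP0).add (hQ.ennreal_ofReal.mul hP1)
    · by_contra hz'
      exact hz.ne (loss_eq_top hz' (Q.nonneg z 1) (Q.prob_le_one z))
  refine ⟨hfin, ?_⟩
  rw [lintegral_loss_eq hfin] at hne
  exact (lintegral_ofReal_ne_top_iff_integrable (measurable_logCost P Q).aestronglyMeasurable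
    (.of_forall (logCost_prob_nonneg P Q))).1 hne

variable (G) in
/-- The integrand of the Lagrangian. -/
def costAt (θ : Fin m → ℝ) (lam : Fin 2 → ℝ) (P Q : CondProb X) (z : X × Fin 2) : ℝ :=
  cost (G.penalty z.2) (G.tilt θ lam z) (P.prob z 1) (Q.prob z 1)

theorem costAt_eq (θ : Fin m → ℝ) (lam : Fin 2 → ℝ) (P Q : CondProb X) :
    G.costAt θ lam P Q = (fun z => logCost (P.prob z 1) (Q.prob z 1)) +
      (fun z => Q.prob z 1 * (P.prob z 1 * G.penalty z.2)) +
        fun z => Q.prob z 1 * G.tilt θ lam z := by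
  ext z
  simp only [costAt, cost, Pi.add_apply]
  ring

theorem IsRegular.integrable_penalty (hG : G.IsRegular) (P Q : CondProb X) :
    Integrable (fun z => Q.prob z 1 * (P.prob z 1 * G.penalty z.2)) G.trg :=
  have := hG.trg
  Q.integrable_mul (P.integrable_mul (integrable_comp_snd G.trg G.penalty))

theorem LossFinite.integrable_costAt {P Q : CondProb X} (h : G.LossFinite P Q)
    (hG : G.IsRegular) (θ : Fin m → ℝ) (lam : Fin 2 → ℝ) :
    Integrable (G.costAt θ lam P Q) G.trg := by
  rw [costAt_eq]
  exact (h.2.add (hG.integrable_penalty P Q)).add (Q.integrable_mul (hG.integrable_tilt θ lam))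

theorem lagrangian_eq_add (θ : Fin m → ℝ) (lam : Fin 2 → ℝ) (P Q : CondProb X) :
    G.lagrangian θ lam P Q = G.objective P Q + (G.violation θ lam Q : EReal) := rfl

theorem LossFinite.lagrangian_eq {P Q : CondProb X} (h : G.LossFinite P Q)
    (hG : G.IsRegular) (θ : Fin m → ℝ) (lam : Fin 2 → ℝ) :
    G.lagrangian θ lam P Q =
      ((∫ z, G.costAt θ lam P Q z ∂G.trg + G.shift θ lam : ℝ) : EReal) := by
  have h0 : 0 ≤ ∫ z, logCost (P.prob z 1) (Q.prob z 1) ∂G.trg :=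
    integral_nonneg (logCost_prob_nonneg P Q)
  rw [lagrangian_eq_add, objective, h.expLogLoss_eq, hG.violation_eq, fairPenalty_eq, costAt_eq,
    integral_add' (h.2.add (hG.integrable_penalty P Q))
      (Q.integrable_mul (hG.integrable_tilt θ lam)),
    integral_add' h.2 (hG.integrable_penalty P Q), EReal.coe_ennreal_ofReal, max_eq_left h0,
    ← EReal.coe_add, ← EReal.coe_add]
  congr 1
  ring

theorem lagrangian_eq_top {P Q : CondProb X} (h : ¬ G.LossFinite P Q) (θ : Fin m → ℝ)
    (lam : Fin 2 → ℝ) : G.lagrangian θ lam P Q = ⊤ := by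
  rw [lagrangian_eq_add, objective, expLogLoss_eq_top h, EReal.coe_ennreal_top,
    EReal.top_add_coe, EReal.top_add_coe]

theorem Feasible.lagrangian_eq {Q : CondProb X} (h : G.Feasible Q) (θ : Fin m → ℝ)
    (lam : Fin 2 → ℝ) (P : CondProb X) : G.lagrangian θ lam P Q = G.objective P Q := by
  rw [lagrangian_eq_add, feasible_iff_violation.1 h, EReal.coe_zero, add_zero]

end Game

namespace Game

variable {X : Type*} [MeasurableSpace X] {m : ℕ} {G : Game X m} {θ : Fin m → ℝ} {lam : Fin 2 → ℝ}
  {P Q : CondProb X}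

theorem SolvesTruncated.lossFinite (h : G.SolvesTruncated θ lam P) (hG : G.IsRegular)
    (Q : CondProb X) : G.LossFinite P Q := by
  have := hG.trg
  rw [solvesTruncated_iff] at h
  refine ⟨h.mono fun z hz => hz.1.finiteLoss _, ?_⟩
  have hb := ((integrable_comp_snd G.trg fun a => logBound (G.penalty a)).add
    (hG.integrable_tilt θ lam).abs).const_mul 2
  refine hb.mono' (measurable_logCost P Q).aestronglyMeasurable (h.mono fun z hz => ?_)
  have e := abs_logCost_le (p := P.prob z 1) (Q.nonneg z 1) (Q.prob_le_one z)
  have e' := hz.abs_log_le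
  rw [Real.norm_eq_abs]
  simp only [Pi.add_apply]
  linarith

/-- A solution of the truncated equation and its adversary form an equilibrium. -/
theorem SolvesTruncated.isEquilibrium (h : G.SolvesTruncated θ lam P) (hG : G.IsRegular)
    (hQ : G.IsAdversaryOf P Q) : G.IsEquilibrium θ lam P Q := by
  have hf := h.lossFinite hG
  rw [solvesTruncated_iff] at h
  rw [isAdversaryOf_iff] at hQ
  refine ⟨fun Q' => ?_, fun P' => ?_⟩
  · rw [(hf Q').lagrangian_eq hG, (hf Q).lagrangian_eq hG, EReal.coe_le_coe_iff]
    refine add_le_add_left (integral_mono_ae ((hf Q').integrable_costAt hG θ lam)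
      ((hf Q).integrable_costAt hG θ lam) ?_) _
    filter_upwards [h, hQ] with z hz hqz
    rw [costAt, costAt, hqz]
    exact hz.cost_le (Q'.prob_le_one z)
  · by_cases hf' : G.LossFinite P' Q
    · rw [(hf Q).lagrangian_eq hG, hf'.lagrangian_eq hG, EReal.coe_le_coe_iff]
      refine add_le_add_left (integral_mono_ae ((hf Q).integrable_costAt hG θ lam)
        (hf'.integrable_costAt hG θ lam) ?_) _
      filter_upwards [h, hQ, hf'.1] with z hz hqz hfz
      rw [hqz] at hfz
      rw [costAt, costAt, hqz]
      exact hz.1.cost_le (P'.nonneg z 1) (P'.prob_le_one z) hfz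
    · rw [lagrangian_eq_top hf']
      exact le_top

/-- The best response to the adversary is unique. -/
theorem SolvesTruncated.ae_eq_of_le (h : G.SolvesTruncated θ lam P) (hG : G.IsRegular)
    (hQ : G.IsAdversaryOf P Q) {P' : CondProb X}
    (hle : G.lagrangian θ lam P' Q ≤ G.lagrangian θ lam P Q) :
    ∀ᵐ z ∂G.trg, P'.prob z 1 = P.prob z 1 := by
  have hf := h.lossFinite hG Q
  have hle' := (h.isEquilibrium hG hQ).2 P'
  rw [solvesTruncated_iff] at h
  rw [isAdversaryOf_iff] at hQ
  have hf' : G.LossFinite P' Q := by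
    by_contra hf'
    rw [lagrangian_eq_top hf', hf.lagrangian_eq hG] at hle
    exact EReal.coe_ne_top _ (top_le_iff.1 hle)
  have heq := le_antisymm hle hle'
  rw [hf.lagrangian_eq hG, hf'.lagrangian_eq hG, EReal.coe_eq_coe_iff, add_left_inj] at heq
  have hae : G.costAt θ lam P Q ≤ᵐ[G.trg] G.costAt θ lam P' Q := by
    filter_upwards [h, hQ, hf'.1] with z hz hqz hfz
    rw [hqz] at hfz
    rw [costAt, costAt, hqz]
    exact hz.1.cost_le (P'.nonneg z 1) (P'.prob_le_one z) hfz
  have := (integral_eq_iff_of_ae_le (hf.integrable_costAt hG θ lam)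
    (hf'.integrable_costAt hG θ lam) hae).1 heq.symm
  filter_upwards [this, h, hQ, hf'.1] with z hcz hz hqz hfz
  rw [hqz] at hfz
  rw [costAt, costAt, hqz] at hcz
  by_contra hne
  exact (hz.1.cost_lt (P'.nonneg z 1) (P'.prob_le_one z) hfz hne).ne hcz

theorem SolvesTruncated.congr (h : G.SolvesTruncated θ lam P) {P' : CondProb X}
    (heq : ∀ᵐ z ∂G.trg, P'.prob z 1 = P.prob z 1) : G.SolvesTruncated θ lam P' := by
  rw [solvesTruncated_iff] at h ⊢
  filter_upwards [h, heq] with z hz hez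
  rwa [hez]

theorem IsAdversaryOf.congr (h : G.IsAdversaryOf P Q) {P' : CondProb X}
    (heq : ∀ᵐ z ∂G.trg, P'.prob z 1 = P.prob z 1) : G.IsAdversaryOf P' Q := by
  rw [isAdversaryOf_iff] at h ⊢
  filter_upwards [h, heq] with z hz hez
  rwa [hez]

/-- An adversary against which a solution of the truncated equation is a best response is given
by the adversary formula. -/
theorem SolvesTruncated.isAdversaryOf (h : G.SolvesTruncated θ lam P) (hG : G.IsRegular)
    (hbest : ∀ P', G.lagrangian θ lam P Q ≤ G.lagrangian θ lam P' Q) : G.IsAdversaryOf P Q := by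
  have := hG.trg
  have hf := h.lossFinite hG Q
  rw [solvesTruncated_iff] at h
  have hP := P.measurable_one
  have hQ := Q.measurable_one
  have hrat : ∀ r : ℚ, ∀ᵐ z ∂G.trg, 0 < (r : ℝ) → (r : ℝ) < 1 →
      cost (G.penalty z.2) (G.tilt θ lam z) (P.prob z 1) (Q.prob z 1) ≤
        cost (G.penalty z.2) (G.tilt θ lam z) r (Q.prob z 1) := by
    intro r
    by_cases hr : 0 < (r : ℝ) ∧ (r : ℝ) < 1
    swap
    · exact .of_forall fun z h0 h1 => absurd ⟨h0, h1⟩ hr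
    have hpen : Measurable fun z : X × Fin 2 => G.penalty z.2 :=
      (measurable_of_countable G.penalty).comp measurable_snd
    have hA : MeasurableSet {z | cost (G.penalty z.2) 0 r (Q.prob z 1) <
        cost (G.penalty z.2) 0 (P.prob z 1) (Q.prob z 1)} := by
      unfold cost logCost
      exact measurableSet_lt (by fun_prop) (by fun_prop)
    classical
    let f : X × Fin 2 → ℝ := fun z => if cost (G.penalty z.2) 0 r (Q.prob z 1) <
      cost (G.penalty z.2) 0 (P.prob z 1) (Q.prob z 1) then r else P.prob z 1
    have hfm : Measurable f := Measurable.ite hA measurable_const hP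
    let P' := CondProb.clamp f hfm
    have hP' : ∀ z, P'.prob z 1 = f z := fun z => by
      refine CondProb.clamp_prob hfm ?_ ?_
      · simp only [f]
        split_ifs
        exacts [hr.1.le, P.nonneg z 1]
      · simp only [f]
        split_ifs
        exacts [hr.2.le, P.prob_le_one z]
    have hf' : G.LossFinite P' Q := by
      constructor
      · filter_upwards [h] with z hz
        rw [hP']
        simp only [f]
        split_ifs
        exacts [.of_mem _ hr.1 hr.2, hz.1.finiteLoss _]
      · refine (hf.2.abs.add (integrable_const (|Real.log r| + |Real.log (1 - r)|))).mono'
          (measurable_logCost P' Q).aestronglyMeasurable (.of_forall fun z => ?_)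
        have e := abs_logCost_le (p := (r : ℝ)) (Q.nonneg z 1) (Q.prob_le_one z)
        rw [hP', Real.norm_eq_abs]
        simp only [f, Pi.add_apply]
        split_ifs
        · linarith [abs_nonneg (logCost (P.prob z 1) (Q.prob z 1))]
        · linarith [abs_nonneg (Real.log r), abs_nonneg (Real.log (1 - r))]
    have hle : G.costAt θ lam P' Q ≤ᵐ[G.trg] G.costAt θ lam P Q := by
      refine .of_forall fun z => ?_
      rw [costAt, costAt, hP']
      simp only [f]
      split_ifs with hz
      · unfold cost at hz ⊢
        linarith
      · exact le_rfl
    have hge := hbest P'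
    rw [hf.lagrangian_eq hG, hf'.lagrangian_eq hG, EReal.coe_le_coe_iff] at hge
    have hint := (hf.integrable_costAt hG θ lam)
    have hint' := (hf'.integrable_costAt hG θ lam)
    have heq := (integral_eq_iff_of_ae_le hint' hint hle).1
      (le_antisymm (integral_mono_ae hint' hint hle) (by linarith))
    filter_upwards [heq] with z hz _ _
    by_contra hlt
    have hlt' : cost (G.penalty z.2) 0 r (Q.prob z 1) <
        cost (G.penalty z.2) 0 (P.prob z 1) (Q.prob z 1) := by
      unfold cost at hlt ⊢
      linarith
    rw [costAt, costAt, hP'] at hz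
    simp only [f, if_pos hlt'] at hz
    exact hlt hz.ge
  rw [isAdversaryOf_iff]
  filter_upwards [h, ae_all_iff.2 hrat] with z hz hrz
  exact hz.1.eq_advProb hrz

theorem measurable_comp_prod {F : ℝ → ℝ → ℝ} (hF : ∀ c, Continuous (F c)) (c : Fin 2 → ℝ)
    {f : X × Fin 2 → ℝ} (hf : Measurable f) : Measurable fun z => F (c z.2) (f z) :=
  measurable_from_prod_countable_left fun a =>
    (hF (c a)).measurable.comp (hf.comp measurable_prodMk_right)

theorem IsRegular.exists_solvesTruncated (hG : G.IsRegular) (θ : Fin m → ℝ) (lam : Fin 2 → ℝ) :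
    ∃ P : CondProb X, G.SolvesTruncated θ lam P := by
  have ht := (hG.integrable_tilt θ lam).aestronglyMeasurable.aemeasurable
  have hm := measurable_comp_prod continuous_robustProb G.penalty ht.measurable_mk
  refine ⟨CondProb.clamp _ hm, ?_⟩
  rw [solvesTruncated_iff]
  filter_upwards [ht.ae_eq_mk] with z hz
  have hb := isBalanced_robustProb (G.penalty z.2) (ht.mk _ z)
  obtain ⟨h0, h1, -⟩ := predRange_iff.1 hb.1
  rw [CondProb.clamp_prob hm h0.le h1.le]
  rwa [← hz] at hb ⊢

theorem SolvesTruncated.exists_isAdversaryOf (h : G.SolvesTruncated θ lam P) :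
    ∃ Q : CondProb X, G.IsAdversaryOf P Q := by
  rw [solvesTruncated_iff] at h
  have hm : Measurable fun z : X × Fin 2 => advProb (G.penalty z.2) (P.prob z 1) := by
    have hP := P.measurable_one
    have hpen : Measurable fun z : X × Fin 2 => G.penalty z.2 :=
      (measurable_of_countable G.penalty).comp measurable_snd
    unfold advProb
    fun_prop
  refine ⟨CondProb.clamp _ hm, ?_⟩
  rw [isAdversaryOf_iff]
  exact h.mono fun z hz => CondProb.clamp_prob hm hz.1.advProb_pos.le hz.1.advProb_le_one

theorem SolvesTruncated.ae_eq_robustProb (h : G.SolvesTruncated θ lam P) :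
    ∀ᵐ z ∂G.trg, P.prob z 1 = robustProb (G.penalty z.2) (G.tilt θ lam z) :=
  (solvesTruncated_iff.1 h).mono fun _ hz => (isBalanced_robustProb _ _).unique hz

theorem isEquilibrium_iff (hG : G.IsRegular) :
    G.IsEquilibrium θ lam P Q ↔ G.SolvesTruncated θ lam P ∧ G.IsAdversaryOf P Q := by
  refine ⟨fun he => ?_, fun h => h.1.isEquilibrium hG h.2⟩
  obtain ⟨P₀, hP₀⟩ := hG.exists_solvesTruncated θ lam
  obtain ⟨Q₀, hQ₀⟩ := hP₀.exists_isAdversaryOf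
  have he₀ := hP₀.isEquilibrium hG hQ₀
  have e1 : G.lagrangian θ lam P Q₀ ≤ G.lagrangian θ lam P₀ Q₀ :=
    (he.1 Q₀).trans ((he.2 P₀).trans (he₀.1 Q))
  have heq := hP₀.ae_eq_of_le hG hQ₀ e1
  have e2 : ∀ P', G.lagrangian θ lam P₀ Q ≤ G.lagrangian θ lam P' Q := fun P' =>
    (he₀.1 Q).trans ((he₀.2 P).trans ((he.1 Q₀).trans (he.2 P')))
  exact ⟨hP₀.congr heq, (hP₀.isAdversaryOf hG e2).congr heq⟩

theorem IsEquilibrium.dual_eq (he : G.IsEquilibrium θ lam P Q) :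
    G.dual θ lam = G.lagrangian θ lam P Q :=
  le_antisymm (iInf_le_of_le P (iSup_le he.1))
    (le_iInf fun P' => (he.2 P').trans (le_iSup (fun Q => G.lagrangian θ lam P' Q) Q))

theorem IsRegular.dual_eq (hG : G.IsRegular) (θ : Fin m → ℝ) (lam : Fin 2 → ℝ) :
    G.dual θ lam = ((∫ z, gameValue (G.penalty z.2) (G.tilt θ lam z) ∂G.trg +
      G.shift θ lam : ℝ) : EReal) := by
  obtain ⟨P, hP⟩ := hG.exists_solvesTruncated θ lam
  obtain ⟨Q, hQ⟩ := hP.exists_isAdversaryOf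
  rw [(hP.isEquilibrium hG hQ).dual_eq, (hP.lossFinite hG Q).lagrangian_eq hG]
  congr 2
  refine integral_congr_ae ?_
  filter_upwards [hP.ae_eq_robustProb, isAdversaryOf_iff.1 hQ] with z hpz hqz
  rw [costAt, gameValue, hqz, hpz]

theorem violation_add_smul (θ θ' : Fin m → ℝ) (lam lam' : Fin 2 → ℝ) (t : ℝ) (Q : CondProb X) :
    G.violation (θ + t • θ') (lam + t • lam') Q =
      G.violation θ lam Q + t * G.violation θ' lam' Q := by
  simp only [violation, add_dotProduct, smul_dotProduct, Pi.add_apply, Pi.smul_apply, add_mul,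
    Finset.sum_add_distrib, smul_eq_mul, mul_add, Finset.mul_sum, mul_assoc]
  ring

theorem tilt_add_smul (θ θ' : Fin m → ℝ) (lam lam' : Fin 2 → ℝ) (t : ℝ) (z : X × Fin 2) :
    G.tilt (θ + t • θ') (lam + t • lam') z = G.tilt θ lam z + t * G.tilt θ' lam' z := by
  simp only [tilt, add_dotProduct, smul_dotProduct, Pi.add_apply, Pi.smul_apply, add_mul,
    Finset.sum_add_distrib, smul_eq_mul, mul_add, Finset.mul_sum, mul_assoc]
  ring

theorem IsDualOptimal.violation_nonneg_of_pos (hd : G.IsDualOptimal θ lam) (hG : G.IsRegular)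
    {θ' : Fin m → ℝ} {lam' : Fin 2 → ℝ} {t : ℝ} (ht : 0 < t)
    (he : G.IsEquilibrium (θ + t • θ') (lam + t • lam') P Q) : 0 ≤ G.violation θ' lam' Q := by
  obtain ⟨P₀, hP₀⟩ := hG.exists_solvesTruncated θ lam
  obtain ⟨Q₀, hQ₀⟩ := hP₀.exists_isAdversaryOf
  have he₀ := hP₀.isEquilibrium hG hQ₀
  have h1 := (hd (θ + t • θ') (lam + t • lam')).trans (he.dual_eq.le.trans (he.2 P₀))
  rw [lagrangian_eq_add, violation_add_smul, EReal.coe_add, ← add_assoc,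
    ← lagrangian_eq_add] at h1
  have h2 := h1.trans (add_le_add_left (he₀.1 Q) _)
  rw [← he₀.dual_eq, hG.dual_eq, ← EReal.coe_add, EReal.coe_le_coe_iff] at h2
  exact nonneg_of_mul_nonneg_right (by linarith) ht

/-- The violation of the constraints by the adversary is the gradient of the dual function. -/
theorem IsDualOptimal.violation_nonneg (hd : G.IsDualOptimal θ lam) (hG : G.IsRegular)
    (hP : G.SolvesTruncated θ lam P) (hQ : G.IsAdversaryOf P Q) (θ' : Fin m → ℝ)
    (lam' : Fin 2 → ℝ) : 0 ≤ G.violation θ' lam' Q := by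
  choose Pt hPt using fun n : ℕ => hG.exists_solvesTruncated
    (θ + (1 / ((n : ℝ) + 1)) • θ') (lam + (1 / ((n : ℝ) + 1)) • lam')
  choose Qt hQt using fun n => (hPt n).exists_isAdversaryOf
  have hnn : ∀ n, 0 ≤ G.violation θ' lam' (Qt n) := fun n =>
    hd.violation_nonneg_of_pos hG (by positivity) ((hPt n).isEquilibrium hG (hQt n))
  have ht := hG.integrable_tilt θ' lam'
  have hlim : Filter.Tendsto (fun n => ∫ z, (Qt n).prob z 1 * G.tilt θ' lam' z ∂G.trg)
      Filter.atTop (nhds (∫ z, Q.prob z 1 * G.tilt θ' lam' z ∂G.trg)) := by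
    refine tendsto_integral_of_dominated_convergence (fun z => |G.tilt θ' lam' z|)
      (fun n => ((Qt n).integrable_mul ht).aestronglyMeasurable) ht.abs
      (fun n => .of_forall fun z => ?_) ?_
    · rw [Real.norm_eq_abs, abs_mul, abs_of_nonneg ((Qt n).nonneg z 1)]
      exact mul_le_of_le_one_left (abs_nonneg _) ((Qt n).prob_le_one z)
    · filter_upwards [hP.ae_eq_robustProb, isAdversaryOf_iff.1 hQ,
        ae_all_iff.2 fun n => (hPt n).ae_eq_robustProb,
        ae_all_iff.2 fun n => isAdversaryOf_iff.1 (hQt n)] with z hpz hqz hptz hqtz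
      simp only [hqz, hpz, hqtz, hptz, tilt_add_smul]
      refine Filter.Tendsto.mul_const _ ?_
      refine ((continuous_advProb_robustProb (G.penalty z.2)).tendsto _).comp ?_
      have := (tendsto_one_div_add_atTop_nhds_zero_nat (𝕜 := ℝ)).mul_const (G.tilt θ' lam' z)
      simpa using this.const_add (G.tilt θ lam z)
  rw [hG.violation_eq]
  refine ge_of_tendsto' (hlim.add_const _) fun n => ?_
  rw [← hG.violation_eq]
  exact hnn n

theorem IsDualOptimal.feasible (hd : G.IsDualOptimal θ lam) (hG : G.IsRegular)
    (hP : G.SolvesTruncated θ lam P) (hQ : G.IsAdversaryOf P Q) : G.Feasible Q := by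
  rw [feasible_iff_violation]
  intro θ' lam'
  have h1 := hd.violation_nonneg hG hP hQ θ' lam'
  have h2 := hd.violation_nonneg hG hP hQ ((0 : Fin m → ℝ) + (-1 : ℝ) • θ')
    ((0 : Fin 2 → ℝ) + (-1 : ℝ) • lam')
  rw [violation_add_smul] at h2
  have h3 : G.violation 0 0 Q = 0 := by simp [violation]
  linarith

theorem IsDualOptimal.isSaddle (hd : G.IsDualOptimal θ lam) (hG : G.IsRegular)
    (hP : G.SolvesTruncated θ lam P) (hQ : G.IsAdversaryOf P Q) : G.IsSaddle P Q := by
  have hfeas := hd.feasible hG hP hQ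
  have he := hP.isEquilibrium hG hQ
  refine ⟨hfeas, fun Q' hQ' => ?_, fun P' => ?_⟩
  · rw [← hfeas.lagrangian_eq θ lam, ← hQ'.lagrangian_eq θ lam]
    exact he.1 Q'
  · rw [← hfeas.lagrangian_eq θ lam, ← hfeas.lagrangian_eq θ lam]
    exact he.2 P'

theorem IsSaddle.iSup_eq (h : G.IsSaddle P Q) :
    (⨆ (Q : CondProb X) (_ : G.Feasible Q), G.objective P Q) = G.objective P Q :=
  le_antisymm (iSup₂_le h.2.1) (le_iSup₂ (f := fun Q (_ : G.Feasible Q) => G.objective P Q) Q h.1)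

theorem IsSaddle.isFairRobust (h : G.IsSaddle P Q) : G.IsFairRobust P := fun P' => by
  rw [h.iSup_eq]
  exact (h.2.2 P').trans
    (le_iSup₂ (f := fun Q (_ : G.Feasible Q) => G.objective P' Q) Q h.1)

theorem IsDualOptimal.isFairRobust_iff (hd : G.IsDualOptimal θ lam) (hG : G.IsRegular) :
    G.IsFairRobust P ↔ G.SolvesTruncated θ lam P := by
  constructor
  · intro hP
    obtain ⟨P₀, hP₀⟩ := hG.exists_solvesTruncated θ lam
    obtain ⟨Q₀, hQ₀⟩ := hP₀.exists_isAdversaryOf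
    have hs := hd.isSaddle hG hP₀ hQ₀
    have hle := (le_iSup₂ (f := fun Q (_ : G.Feasible Q) => G.objective P Q) Q₀ hs.1).trans (hP P₀)
    rw [hs.iSup_eq, ← hs.1.lagrangian_eq θ lam, ← hs.1.lagrangian_eq θ lam] at hle
    exact hP₀.congr (hP₀.ae_eq_of_le hG hQ₀ hle)
  · intro hP
    obtain ⟨Q, hQ⟩ := hP.exists_isAdversaryOf
    exact (hd.isSaddle hG hP hQ).isFairRobust

end Game

section Coercive

variable {X : Type*} [MeasurableSpace X] {ν : Measure (X × Fin 2)}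

/-- The integrated value of the game, as a function of the tilt, when label `1` of a feasible
adversary has probability `q`. -/
def valueIntegral (ν : Measure (X × Fin 2)) (c : Fin 2 → ℝ) (q f : X × Fin 2 → ℝ) : ℝ :=
  ∫ z, (gameValue (c z.2) (f z) - q z * f z) ∂ν

/-- A lower bound of the integrated value, up to constants. -/
def recession (ν : Measure (X × Fin 2)) (q f : X × Fin 2 → ℝ) : ℝ :=
  ∫ z, (max 0 (f z) - q z * f z) ∂ν

theorem abs_integral_sub_integral_le {F : X × Fin 2 → ℝ → ℝ} {K : ℝ}
    (hF : ∀ z s t, |F z s - F z t| ≤ K * |s - t|) (f g : Lp ℝ 1 ν)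
    (hf : Integrable (fun z => F z (f z)) ν) (hg : Integrable (fun z => F z (g z)) ν) :
    |(∫ z, F z (f z) ∂ν) - ∫ z, F z (g z) ∂ν| ≤ K * dist f g := by
  rw [← integral_sub hf hg, L1.dist_eq_integral_dist, ← integral_const_mul]
  refine norm_integral_le_of_norm_le (f := fun z => F z (f z) - F z (g z)) ?_
    (.of_forall fun z => ?_)
  · have := ((L1.integrable_coeFn f).sub (L1.integrable_coeFn g)).abs
    exact this.const_mul K
  · exact hF z _ _

variable {q : X × Fin 2 → ℝ}

theorem integrable_mul_of_mem {f : X × Fin 2 → ℝ} (hq : Measurable q)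
    (hq01 : ∀ z, 0 ≤ q z ∧ q z ≤ 1) (hf : Integrable f ν) :
    Integrable (fun z => q z * f z) ν := by
  refine hf.bdd_mul (c := 1) hq.aestronglyMeasurable (.of_forall fun z => ?_)
  rw [Real.norm_eq_abs, abs_of_nonneg (hq01 z).1]
  exact (hq01 z).2

theorem integrable_gameValue [IsFiniteMeasure ν] (c : Fin 2 → ℝ) {f : X × Fin 2 → ℝ}
    (hf : Integrable f ν) : Integrable (fun z => gameValue (c z.2) (f z)) ν := by
  refine ((integrable_comp_snd ν fun a => |gameValue (c a) 0|).add hf.abs).mono' ?_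
    (.of_forall fun z => ?_)
  · have hm := hf.aestronglyMeasurable.aemeasurable
    refine ⟨_, (Game.measurable_comp_prod continuous_gameValue c
      hm.measurable_mk).stronglyMeasurable, ?_⟩
    filter_upwards [hm.ae_eq_mk] with z hz
    rw [hz]
  · have e1 := abs_gameValue_sub_le (c z.2) (f z) 0
    have e2 := abs_sub_abs_le_abs_sub (gameValue (c z.2) (f z)) (gameValue (c z.2) 0)
    rw [sub_zero] at e1
    simp only [Pi.add_apply, Real.norm_eq_abs]
    linarith

theorem integrable_recession {f : X × Fin 2 → ℝ} (hq : Measurable q)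
    (hq01 : ∀ z, 0 ≤ q z ∧ q z ≤ 1) (hf : Integrable f ν) :
    Integrable (fun z => max 0 (f z) - q z * f z) ν := by
  have : Integrable (fun z => max 0 (f z)) ν := by
    simpa only [max_comm] using hf.pos_part
  exact this.sub (integrable_mul_of_mem hq hq01 hf)

theorem continuous_valueIntegral [IsFiniteMeasure ν] (c : Fin 2 → ℝ) (hq : Measurable q)
    (hq01 : ∀ z, 0 ≤ q z ∧ q z ≤ 1) :
    Continuous fun f : Lp ℝ 1 ν => valueIntegral ν c q f := by
  refine (LipschitzWith.of_dist_le_mul (K := 2) fun f g => ?_).continuous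
  refine abs_integral_sub_integral_le (F := fun z s => gameValue (c z.2) s - q z * s)
    (fun z s t => ?_) f g
    ((integrable_gameValue c (L1.integrable_coeFn f)).sub
      (integrable_mul_of_mem hq hq01 (L1.integrable_coeFn f)))
    ((integrable_gameValue c (L1.integrable_coeFn g)).sub
      (integrable_mul_of_mem hq hq01 (L1.integrable_coeFn g)))
  have e1 := abs_gameValue_sub_le (c z.2) s t
  have e2 : |q z * (s - t)| ≤ |s - t| := by
    rw [abs_mul, abs_of_nonneg (hq01 z).1]
    exact mul_le_of_le_one_left (abs_nonneg _) (hq01 z).2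
  have e3 : gameValue (c z.2) s - q z * s - (gameValue (c z.2) t - q z * t) =
    gameValue (c z.2) s - gameValue (c z.2) t - q z * (s - t) := by ring
  rw [e3]
  refine (abs_sub _ _).trans ?_
  push_cast
  linarith

theorem continuous_recession (hq : Measurable q) (hq01 : ∀ z, 0 ≤ q z ∧ q z ≤ 1) :
    Continuous fun f : Lp ℝ 1 ν => recession ν q f := by
  refine (LipschitzWith.of_dist_le_mul (K := 2) fun f g => ?_).continuous
  refine abs_integral_sub_integral_le (F := fun z s => max 0 s - q z * s)
    (fun z s t => ?_) f g (integrable_recession hq hq01 (L1.integrable_coeFn f))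
    (integrable_recession hq hq01 (L1.integrable_coeFn g))
  have e1 : |max 0 s - max 0 t| ≤ |s - t| := by
    simpa only [max_comm] using abs_max_sub_max_le_abs s t 0
  have e2 : |q z * (s - t)| ≤ |s - t| := by
    rw [abs_mul, abs_of_nonneg (hq01 z).1]
    exact mul_le_of_le_one_left (abs_nonneg _) (hq01 z).2
  have e3 : max 0 s - q z * s - (max 0 t - q z * t) =
    max 0 s - max 0 t - q z * (s - t) := by ring
  rw [e3]
  refine (abs_sub _ _).trans ?_
  push_cast
  linarith

theorem recession_smul (f : Lp ℝ 1 ν) {t : ℝ} (ht : 0 ≤ t) :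
    recession ν q (t • f : Lp ℝ 1 ν) = t * recession ν q f := by
  unfold recession
  rw [← integral_const_mul]
  refine integral_congr_ae ?_
  filter_upwards [Lp.coeFn_smul t f] with z hz
  rw [hz, Pi.smul_apply, smul_eq_mul, mul_sub, mul_max_of_nonneg _ _ ht, mul_zero]
  ring

theorem recession_pos (hq : Measurable q) (hq01 : ∀ z, 0 ≤ q z ∧ q z ≤ 1)
    (hq' : ∀ᵐ z ∂ν, 0 < q z ∧ q z < 1) {f : Lp ℝ 1 ν} (hf : f ≠ 0) : 0 < recession ν q f := by
  have hnn : ∀ z, 0 ≤ max 0 (f z) - q z * f z := fun z => by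
    rcases max_cases 0 (f z) with h | h <;> nlinarith [hq01 z]
  refine lt_of_le_of_ne (integral_nonneg hnn) fun h0 => hf ?_
  have hz := (integral_eq_zero_iff_of_nonneg hnn
    (integrable_recession hq hq01 (L1.integrable_coeFn f))).1 h0.symm
  refine Lp.ext ?_
  filter_upwards [hz, hq', Lp.coeFn_zero ℝ 1 ν] with z hz hqz h0
  rw [h0]
  simp only [Pi.zero_apply] at hz ⊢
  rcases max_cases 0 (f z) with h | h
  · have : q z * f z = 0 := by linarith
    exact (mul_eq_zero.1 this).resolve_left hqz.1.ne'
  · have : (1 - q z) * f z = 0 := by linarith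
    exact (mul_eq_zero.1 this).resolve_left (by linarith)

theorem exists_mul_norm_le_recession (hq : Measurable q) (hq01 : ∀ z, 0 ≤ q z ∧ q z ≤ 1)
    (hq' : ∀ᵐ z ∂ν, 0 < q z ∧ q z < 1) (V : Submodule ℝ (Lp ℝ 1 ν)) [FiniteDimensional ℝ V] :
    ∃ κ > 0, ∀ f : V, κ * ‖f‖ ≤ recession ν q (f : Lp ℝ 1 ν) := by
  have : ProperSpace V := FiniteDimensional.proper_real V
  have hcont : Continuous fun f : V => recession ν q (f : Lp ℝ 1 ν) :=
    (continuous_recession hq hq01).comp continuous_subtype_val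
  have hzero : recession ν q ((0 : Lp ℝ 1 ν)) = 0 := by
    simpa using recession_smul (q := q) (0 : Lp ℝ 1 ν) le_rfl
  rcases (Metric.sphere (0 : V) 1).eq_empty_or_nonempty with hE | hne
  · refine ⟨1, one_pos, fun f => ?_⟩
    have : f = 0 := by
      by_contra hf
      have hmem : ‖f‖⁻¹ • f ∈ Metric.sphere (0 : V) 1 := by
        rw [mem_sphere_zero_iff_norm, norm_smul, norm_inv, norm_norm,
          inv_mul_cancel₀ (norm_ne_zero_iff.2 hf)]
      rw [hE] at hmem
      exact hmem
    rw [this, norm_zero, mul_zero]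
    exact hzero.ge
  · obtain ⟨f₀, hf₀, hmin⟩ := (isCompact_sphere (0 : V) 1).exists_isMinOn hne hcont.continuousOn
    have hf₀' : (f₀ : Lp ℝ 1 ν) ≠ 0 := by
      intro h
      rw [mem_sphere_zero_iff_norm, Submodule.coe_eq_zero.1 h, norm_zero] at hf₀
      exact zero_ne_one hf₀
    refine ⟨_, recession_pos hq hq01 hq' hf₀', fun f => ?_⟩
    rcases eq_or_ne f 0 with rfl | hf
    · rw [norm_zero, mul_zero]
      exact hzero.ge
    · have hn := norm_ne_zero_iff.2 hf
      have hmem : ‖f‖⁻¹ • f ∈ Metric.sphere (0 : V) 1 := by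
        rw [mem_sphere_zero_iff_norm, norm_smul, norm_inv, norm_norm, inv_mul_cancel₀ hn]
      have hle : recession ν q (f₀ : Lp ℝ 1 ν) ≤
          recession ν q ((‖f‖⁻¹ • f : V) : Lp ℝ 1 ν) := hmin hmem
      rw [Submodule.coe_smul, recession_smul _ (by positivity), inv_mul_eq_div,
        le_div_iff₀ (by positivity)] at hle
      exact hle

theorem recession_sub_le_valueIntegral [IsFiniteMeasure ν] (c : Fin 2 → ℝ) (hq : Measurable q)
    (hq01 : ∀ z, 0 ≤ q z ∧ q z ≤ 1) (f : Lp ℝ 1 ν) :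
    recession ν q f - ∫ z, |c z.2| ∂ν ≤ valueIntegral ν c q f := by
  have hf := L1.integrable_coeFn f
  have hc := integrable_comp_snd ν fun a => |c a|
  unfold recession valueIntegral
  rw [← integral_sub (integrable_recession hq hq01 hf) hc]
  refine integral_mono ((integrable_recession hq hq01 hf).sub hc)
    ((integrable_gameValue c hf).sub (integrable_mul_of_mem hq hq01 hf)) fun z => ?_
  have := max_zero_sub_le_gameValue (c z.2) (f z)
  simp only
  linarith

/-- The integrated value attains its minimum over a finite-dimensional space of tilts. -/
theorem exists_forall_valueIntegral_le [IsFiniteMeasure ν] (c : Fin 2 → ℝ) (hq : Measurable q)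
    (hq01 : ∀ z, 0 ≤ q z ∧ q z ≤ 1) (hq' : ∀ᵐ z ∂ν, 0 < q z ∧ q z < 1)
    (V : Submodule ℝ (Lp ℝ 1 ν)) [FiniteDimensional ℝ V] :
    ∃ f : V, ∀ g : V, valueIntegral ν c q (f : Lp ℝ 1 ν) ≤
      valueIntegral ν c q (g : Lp ℝ 1 ν) := by
  have : ProperSpace V := FiniteDimensional.proper_real V
  obtain ⟨κ, hκ, hle⟩ := exists_mul_norm_le_recession hq hq01 hq' V
  have hcont : Continuous fun f : V => valueIntegral ν c q (f : Lp ℝ 1 ν) :=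
    (continuous_valueIntegral c hq hq01).comp continuous_subtype_val
  refine hcont.exists_forall_le ?_
  refine Filter.tendsto_atTop_mono (f := fun f : V => κ * ‖f‖ + -∫ z, |c z.2| ∂ν) (fun f => ?_) ?_
  · have := recession_sub_le_valueIntegral c hq hq01 (f : Lp ℝ 1 ν)
    have := hle f
    linarith
  · exact Filter.tendsto_atTop_add_const_right _ _
      ((tendsto_norm_cocompact_atTop (E := V)).const_mul_atTop hκ)

end Coercive

namespace Game

variable {X : Type*} [MeasurableSpace X] {m : ℕ} {G : Game X m}

/-- The tilt as a linear map of the multipliers. -/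
def tiltMap (hG : G.IsRegular) : ((Fin m → ℝ) × (Fin 2 → ℝ)) →ₗ[ℝ] Lp ℝ 1 G.trg where
  toFun v := (hG.integrable_tilt v.1 v.2).toL1
  map_add' v w := by
    rw [← Integrable.toL1_add]
    congr 1
    ext z
    simpa using tilt_add_smul (G := G) v.1 w.1 v.2 w.2 1 z
  map_smul' t v := by
    rw [RingHom.id_apply, ← Integrable.toL1_smul]
    congr 1
    ext z
    have h0 : G.tilt 0 0 z = 0 := by simp [tilt]
    simpa [h0] using tilt_add_smul (G := G) 0 v.1 0 v.2 t z

theorem Feasible.dual_eq {Q : CondProb X} (hQ : G.Feasible Q) (hG : G.IsRegular) (θ : Fin m → ℝ)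
    (lam : Fin 2 → ℝ) :
    G.dual θ lam = (valueIntegral G.trg G.penalty (fun z => Q.prob z 1)
      (tiltMap hG (θ, lam)) : EReal) := by
  have := hG.trg
  have ht := hG.integrable_tilt θ lam
  have hv := feasible_iff_violation.1 hQ θ lam
  rw [hG.violation_eq] at hv
  rw [hG.dual_eq]
  congr 1
  rw [eq_neg_of_add_eq_zero_right hv, ← sub_eq_add_neg,
    ← integral_sub (integrable_gameValue G.penalty ht) (Q.integrable_mul ht)]
  refine integral_congr_ae ?_
  filter_upwards [ht.coeFn_toL1] with z hz
  rw [tiltMap, LinearMap.coe_mk, AddHom.coe_mk, hz]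

theorem Feasible.exists_isDualOptimal {Q : CondProb X} (hQ : G.Feasible Q) (hG : G.IsRegular)
    (hpos : ∀ᵐ z ∂G.trg, 0 < Q.prob z 1 ∧ Q.prob z 1 < 1) :
    ∃ θ lam, G.IsDualOptimal θ lam := by
  have := hG.trg
  obtain ⟨⟨_, ⟨v, rfl⟩⟩, hv⟩ := exists_forall_valueIntegral_le G.penalty Q.measurable_one
    (fun z => ⟨Q.nonneg z 1, Q.prob_le_one z⟩) hpos (LinearMap.range (tiltMap hG))
  refine ⟨v.1, v.2, fun θ lam => ?_⟩
  rw [hQ.dual_eq hG, hQ.dual_eq hG, EReal.coe_le_coe_iff]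
  exact hv ⟨_, ⟨(θ, lam), rfl⟩⟩

end Game

end FairShift

end

theorem theorem1 {X : Type*} [MeasurableSpace X] {m : ℕ} (G : FairShift.Game X m)
    (hsrc : IsProbabilityMeasure G.src) (htrg : IsProbabilityMeasure G.trg)
    (hac : G.srcXA ≪ G.trg)
    (hfeat : ∀ y : Fin 2, Integrable (fun z : X × Fin 2 => G.feat z.1 y) G.srcXA)
    (hg : ∀ k : Fin 2, 0 < G.gtil k) :
    -- a solution of the first-order equation for dual multipliers is a fair robust predictor,
    -- and together with the adversary formula it gives a saddle point of the constrained game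
    (∀ θ lam, G.IsDualOptimal θ lam → ∀ P : FairShift.CondProb X, G.Solves θ lam P →
      G.IsFairRobust P ∧ ∀ Q, G.IsAdversaryOf P Q → G.IsSaddle P Q) ∧
    -- given arbitrary multipliers and a solution, the adversary formula gives an equilibrium
    (∀ θ lam, ∀ P : FairShift.CondProb X, G.Solves θ lam P →
      (∃ Q, G.IsAdversaryOf P Q) ∧ ∀ Q, G.IsAdversaryOf P Q → G.IsEquilibrium θ lam P Q) ∧
    -- the range condition says exactly that the adversary formula gives a value in `[0, 1]`
    (∀ (a : Fin 2) (p : ℝ), 0 < p → p < 1 →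
      (G.InRange a p ↔
        G.advDenom a p ≠ 0 ∧ 0 ≤ p / G.advDenom a p ∧ p / G.advDenom a p ≤ 1)) ∧
    -- conversely, fair robust predictors and equilibria satisfy the (truncated) equation
    (∀ θ lam, G.IsDualOptimal θ lam → ∀ P : FairShift.CondProb X,
      (G.IsFairRobust P ↔ G.SolvesTruncated θ lam P)) ∧
    (∀ θ lam, ∀ P Q : FairShift.CondProb X,
      (G.IsEquilibrium θ lam P Q ↔ G.SolvesTruncated θ lam P ∧ G.IsAdversaryOf P Q)) ∧
    -- equilibria exist for all multipliers, and dual multipliers exist if some feasible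
    -- adversary takes values strictly between 0 and 1
    (∀ θ lam, ∃ P Q : FairShift.CondProb X, G.IsEquilibrium θ lam P Q) ∧
    ((∃ Q : FairShift.CondProb X, G.Feasible Q ∧
        ∀ᵐ z ∂G.trg, 0 < Q.prob z 1 ∧ Q.prob z 1 < 1) →
      ∃ θ lam, G.IsDualOptimal θ lam) := by
  have hG : G.IsRegular := ⟨hsrc, htrg, hac, hfeat⟩
  refine ⟨fun θ lam hd P hP => ?_, fun θ lam P hP => ?_, fun a p h0 h1 => ?_,
    fun θ lam hd P => hd.isFairRobust_iff hG, fun θ lam P Q => FairShift.Game.isEquilibrium_iff hG,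
    fun θ lam => ?_, ?_⟩
  · have hT := hP.solvesTruncated
    exact ⟨(hd.isFairRobust_iff hG).2 hT, fun Q hQ => hd.isSaddle hG hT hQ⟩
  · have hT := hP.solvesTruncated
    exact ⟨hT.exists_isAdversaryOf, fun Q hQ => hT.isEquilibrium hG hQ⟩
  · exact FairShift.predRange_iff_advProb (c := G.penalty a) h0 h1
  · obtain ⟨P, hP⟩ := hG.exists_solvesTruncated θ lam
    obtain ⟨Q, hQ⟩ := hP.exists_isAdversaryOf
    exact ⟨P, Q, hP.isEquilibrium hG hQ⟩
  · rintro ⟨Q, hQ, hpos⟩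
    exact hQ.exists_isDualOptimal hG hpos
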